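/- Let $n, k \ge 1$ be integers, let $F$ be a field of characteristic zero, and let $H$ be the hypergraph on the vertex set $\{1,\dots,n\}$ whose hyperedges are all $k$-element subsets containing the vertex $1$. For $r \ge -1$ let $\Lambda_r$ be the set of ordered partitions $(B_1,\dots,B_{r+2})$ of $\{1,\dots,n\}$ into nonempty blocks such that some $B_i$ contains a hyperedge of $H$, and let $C_r$ be the quotient of the $F$-vector space with basis $\Lambda_r$ by the relations $(B_1,\dots,B_{r+2}) \sim (-1)^{r+1}(B_2,\dots,B_{r+2},B_1)$. Write $[B_1,\dots,B_{r+2}]$ for the class of $(B_1,\dots,B_{r+2})$. The cyclic coloring complex $\Delta(H)$ consists of the spaces $C_r$ with the boundary maps $\partial_r : C_r \to C_{r-1}$ ($r \ge 0$), $$\partial_r[B_1,\dots,B_{r+2}] = \sum_{i=1}^{r+1} (-1)^{i+1}[B_1,\dots,B_i\cup B_{i+1},\dots,B_{r+2}] + (-1)^{r+3}[B_1\cup B_{r+2},B_2,\dots,B_{r+1}],$$ and $\partial_{-1}=0$; put $HC_r(\Delta(H)) = \ker\partial_r/\operatorname{im}\partial_{r+1}$. Then for $n-k-1 \ge r \ge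 -1$ the space $HC_r(\Delta(H))$ is nonzero and $$\dim_F HC_r(\Delta(H)) = \binom{n-1}{r+1},$$ while $HC_r(\Delta(H)) = 0$ for $r > n-k-1$ (with $r \ge -1$). Moreover, for $n-k-1 \ge r \ge -1$ a basis of $HC_r(\Delta(H))$ is indexed by the subsets $A \subseteq \{2,\dots,n\}$ of size $n-r-2$: for each such $A$, with $\{a_1<\dots<a_{r+1}\} = \{2,\dots,n\}\setminus A$, the chain $$\sum_{\sigma\in S_{r+1}} \operatorname{sgn}(\sigma)\,[A\cup\{1\}, \{a_{\sigma(1)}\},\dots,\{a_{\sigma(r+1)}\}]$$ is a cycle, and the homology classes of these cycles form a basis of $HC_r(\Delta(H))$. -/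

import Mathlib

open Finset

namespace CyclicColoring

/-- An ordered partition `(B_0, …, B_p)` of the vertex set `Fin n` into `p + 1` nonempty blocks, at
least one of which contains a hyperedge of `H`. It is recorded by the function sending a vertex to
the position of its block, so `B_i = f ⁻¹' {i}`, and the blocks are nonempty iff `f` is surjective.
In the indexing by `r` in which `(B_1, …, B_{r+2})` has degree `r`, one has `p = r + 1`. -/
def Face {n : ℕ} (H : Hypergraph (Fin n)) (p : ℕ) : Type :=
  {f : Fin n → Fin (p + 1) // Function.Surjective f ∧ ∃ e ∈ H.edgeSet, ∃ i, e ⊆ f ⁻¹' {i}}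

/-- Regroup the blocks of an ordered partition along a surjection of their positions. -/
def Face.map {n : ℕ} {H : Hypergraph (Fin n)} {p q : ℕ} (g : Fin (p + 1) → Fin (q + 1))
    (hg : Function.Surjective g) (B : Face H p) : Face H q :=
  ⟨g ∘ B.1, hg.comp B.2.1, by
    obtain ⟨-, e, he, i, hi⟩ := B.2
    exact ⟨e, he, g i, fun x hx => congrArg g (hi hx)⟩⟩

theorem sub_one_surjective (p : ℕ) : Function.Surjective (fun j : Fin (p + 1) => j - 1) :=
  fun j => ⟨j + 1, by simp⟩

/-- `(B_0, B_1, …, B_p) ↦ (B_1, …, B_p, B_0)`. -/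
def Face.rotate {n : ℕ} {H : Hypergraph (Fin n)} {p : ℕ} (B : Face H p) : Face H p :=
  B.map (fun j => j - 1) (sub_one_surjective p)

/-- `(B_0, …, B_{p+1}) ↦ (B_0, …, B_i ∪ B_{i+1}, …, B_{p+1})`. -/
def Face.merge {n : ℕ} {H : Hypergraph (Fin n)} {p : ℕ} (i : Fin (p + 1)) (B : Face H (p + 1)) :
    Face H p :=
  B.map i.predAbove (Fin.predAbove_surjective i)

/-- The map of positions sending the last position to the first one and fixing the others. -/
def wrapIdx (p : ℕ) (j : Fin (p + 2)) : Fin (p + 1) :=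
  if h : (j : ℕ) < p + 1 then ⟨j, h⟩ else 0

theorem wrapIdx_surjective (p : ℕ) : Function.Surjective (wrapIdx p) :=
  fun j => ⟨j.castSucc, by simp only [wrapIdx, Fin.val_castSucc, j.isLt, dif_pos]⟩

/-- `(B_0, …, B_{p+1}) ↦ (B_0 ∪ B_{p+1}, B_1, …, B_p)`. -/
def Face.wrap {n : ℕ} {H : Hypergraph (Fin n)} {p : ℕ} (B : Face H (p + 1)) : Face H p :=
  B.map (wrapIdx p) (wrapIdx_surjective p)

variable (F : Type*) [Field F] {n : ℕ} (H : Hypergraph (Fin n)) (p : ℕ)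

/-- The relations `(B_0, …, B_p) ∼ (-1)^p (B_1, …, B_p, B_0)` on the vector space with basis
`Face H p`. -/
noncomputable def cyclicRel : Submodule F (Face H p →₀ F) :=
  Submodule.span F (Set.range fun B : Face H p =>
    Finsupp.single B 1 - (-1 : F) ^ p • Finsupp.single B.rotate 1)

/-- The space of chains of the cyclic coloring complex `Δ(H)` in degree `r = p - 1`. -/
abbrev Chain : Type _ := (Face H p →₀ F) ⧸ cyclicRel F H p

variable {H p} in
/-- The class `[B_0, …, B_p]` as a chain. -/
noncomputable def bracket (B : Face H p) : Chain F H p :=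
  (cyclicRel F H p).mkQ (Finsupp.single B 1)

/-- The boundary on representatives:
`[B_0, …, B_{p+1}] ↦ ∑_{i=0}^{p} (-1)^i [B_0, …, B_i ∪ B_{i+1}, …, B_{p+1}]
  + (-1)^(p+1) [B_0 ∪ B_{p+1}, B_1, …, B_p]`. -/
noncomputable def preBoundary : (Face H (p + 1) →₀ F) →ₗ[F] Chain F H p :=
  Finsupp.linearCombination F fun B : Face H (p + 1) =>
    ∑ i : Fin (p + 1), (-1 : F) ^ (i : ℕ) • bracket F (B.merge i)
      + (-1 : F) ^ (p + 1) • bracket F B.wrap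

theorem bracket_rotate {H : Hypergraph (Fin n)} {p : ℕ} (B : Face H p) :
    bracket F B = (-1 : F) ^ p • bracket F B.rotate := by
  unfold bracket
  rw [← map_smul, ← sub_eq_zero, ← map_sub, Submodule.mkQ_apply, Submodule.Quotient.mk_eq_zero]
  exact Submodule.subset_span ⟨B, rfl⟩

theorem wrapIdx_val (p : ℕ) (j : Fin (p + 2)) :
    (wrapIdx p j : ℕ) = if (j : ℕ) < p + 1 then (j : ℕ) else 0 := by
  unfold wrapIdx; split_ifs <;> rfl

theorem predAbove_val {p : ℕ} (i : Fin (p + 1)) (j : Fin (p + 2)) :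
    (i.predAbove j : ℕ) = if (i : ℕ) < j then (j : ℕ) - 1 else j := by
  unfold Fin.predAbove
  simp only [Fin.lt_def, Fin.val_castSucc]
  split_ifs <;> simp

theorem sub_one_val {p : ℕ} (j : Fin (p + 1)) :
    ((j - 1 : Fin (p + 1)) : ℕ) = if (j : ℕ) = 0 then p else (j : ℕ) - 1 := by
  rw [Fin.coe_sub_one]
  simp only [Fin.ext_iff, Fin.val_zero]

theorem rotate_merge_castSucc {H : Hypergraph (Fin n)} {p : ℕ} (B : Face H (p + 1)) (i : Fin p) :
    (B.rotate).merge i.castSucc = (B.merge i.succ).rotate := by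
  apply Subtype.ext; funext x; apply Fin.ext
  have h1 := i.isLt
  have h2 := (B.1 x).isLt
  simp only [Face.rotate, Face.merge, Face.map, Function.comp_apply, predAbove_val, sub_one_val,
    Fin.val_castSucc, Fin.val_succ]
  grind

theorem rotate_merge_last {H : Hypergraph (Fin n)} {p : ℕ} (B : Face H (p + 1)) :
    (B.rotate).merge (Fin.last p) = (B.wrap).rotate := by
  apply Subtype.ext; funext x; apply Fin.ext
  have h2 := (B.1 x).isLt
  simp only [Face.rotate, Face.merge, Face.wrap, Face.map, Function.comp_apply, predAbove_val,
    sub_one_val, wrapIdx_val, Fin.val_last]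
  grind

theorem rotate_wrap {H : Hypergraph (Fin n)} {p : ℕ} (B : Face H (p + 1)) :
    (B.rotate).wrap = B.merge 0 := by
  apply Subtype.ext; funext x; apply Fin.ext
  have h2 := (B.1 x).isLt
  simp only [Face.rotate, Face.merge, Face.wrap, Face.map, Function.comp_apply, predAbove_val,
    sub_one_val, wrapIdx_val, Fin.val_zero]
  grind

theorem preBoundary_single {H : Hypergraph (Fin n)} {p : ℕ} (B : Face H (p + 1)) :
    preBoundary F H p (Finsupp.single B 1) =
      ∑ i : Fin (p + 1), (-1 : F) ^ (i : ℕ) • bracket F (B.merge i)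
        + (-1 : F) ^ (p + 1) • bracket F B.wrap := by
  rw [preBoundary, Finsupp.linearCombination_single, one_smul]

/-- The boundary is well defined on equivalence classes. -/
theorem cyclicRel_le_ker : cyclicRel F H (p + 1) ≤ LinearMap.ker (preBoundary F H p) := by
  refine Submodule.span_le.2 ?_
  rintro _ ⟨B, rfl⟩
  rw [SetLike.mem_coe, LinearMap.mem_ker, map_sub, map_smul, preBoundary_single,
    preBoundary_single, rotate_wrap, Fin.sum_univ_succ,
    Fin.sum_univ_castSucc (f := fun i => (-1 : F) ^ (i : ℕ) • bracket F (B.rotate.merge i))]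
  simp only [rotate_merge_castSucc, rotate_merge_last]
  have h1 : ∀ i : Fin p, (-1 : F) ^ (i.succ : ℕ) • bracket F (B.merge i.succ) =
      (-1 : F) ^ (p + 1) • (-1 : F) ^ (i.castSucc : ℕ) • bracket F (B.merge i.succ).rotate := by
    intro i
    rw [bracket_rotate F (B.merge i.succ), smul_smul, smul_smul, Fin.val_succ, Fin.val_castSucc]
    congr 1
    ring
  have h2 : bracket F B.wrap = (-1 : F) ^ p • bracket F B.wrap.rotate := bracket_rotate F _
  have h3 : (-1 : F) ^ (p + 1) * (-1 : F) ^ (p + 1) = 1 := by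
    rw [← mul_pow]; simp
  rw [Finset.sum_congr rfl fun i _ => h1 i, ← Finset.smul_sum, h2, smul_add, smul_add,
    smul_smul ((-1 : F) ^ (p + 1)) ((-1 : F) ^ (p + 1)) (bracket F (B.merge 0)), h3]
  simp only [Fin.val_zero, pow_zero, Fin.val_last, one_smul]
  abel

/-- The boundary map `∂_r : C_r → C_{r-1}` with `r = p`. -/
noncomputable def boundary : Chain F H (p + 1) →ₗ[F] Chain F H p :=
  (cyclicRel F H (p + 1)).liftQ (preBoundary F H p) (cyclicRel_le_ker F H p)

theorem boundary_bracket {H : Hypergraph (Fin n)} {p : ℕ} (B : Face H (p + 1)) :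
    boundary F H p (bracket F B) =
      ∑ i : Fin (p + 1), (-1 : F) ^ (i : ℕ) • bracket F (B.merge i)
        + (-1 : F) ^ (p + 1) • bracket F B.wrap := by
  rw [← preBoundary_single]
  exact Submodule.liftQ_apply _ _ _

/-- The faces `merge 0, …, merge p, wrap`, indexed together. -/
def Face.face {n : ℕ} {H : Hypergraph (Fin n)} {p : ℕ} (i : Fin (p + 2)) (B : Face H (p + 1)) :
    Face H p :=
  if h : (i : ℕ) < p + 1 then B.merge ⟨i, h⟩ else B.wrap

theorem boundary_bracket_eq_sum {H : Hypergraph (Fin n)} {p : ℕ} (B : Face H (p + 1)) :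
    boundary F H p (bracket F B) =
      ∑ i : Fin (p + 2), (-1 : F) ^ (i : ℕ) • bracket F (B.face i) := by
  rw [boundary_bracket, Fin.sum_univ_castSucc (n := p + 1)]
  congr 1
  · refine Finset.sum_congr rfl fun i _ => ?_
    simp only [Face.face, Fin.val_castSucc, i.isLt, dif_pos]
  · simp only [Face.face, Fin.val_last, lt_irrefl, dif_neg, not_false_eq_true]

theorem face_val {H : Hypergraph (Fin n)} {p : ℕ} (i : Fin (p + 2)) (B : Face H (p + 1))
    (x : Fin n) : (((B.face i).1 x : Fin (p + 1)) : ℕ) =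
      if (i : ℕ) < B.1 x then (if (i : ℕ) < p + 1 then (B.1 x : ℕ) - 1 else 0)
      else if (B.1 x : ℕ) < p + 1 then B.1 x else 0 := by
  have h2 := (B.1 x).isLt
  have h3 := i.isLt
  unfold Face.face
  split_ifs <;> simp only [Face.merge, Face.wrap, Face.map, Function.comp_apply, predAbove_val,
    wrapIdx_val] <;> grind

theorem face_face {H : Hypergraph (Fin n)} {p : ℕ} (B : Face H (p + 2)) (i : Fin (p + 2))
    (j : Fin (p + 3)) (hij : (j : ℕ) ≤ i) :
    (B.face j).face i =
      (B.face i.succ).face (Fin.castLT j (lt_of_le_of_lt hij i.isLt)) := by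
  apply Subtype.ext; funext x; apply Fin.ext
  have h1 := i.isLt
  have h2 := (B.1 x).isLt
  simp only [face_val, Fin.val_succ, Fin.val_castLT]
  grind

theorem boundary_boundary_bracket {H : Hypergraph (Fin n)} {p : ℕ} (B : Face H (p + 2)) :
    boundary F H p (boundary F H (p + 1) (bracket F B)) = 0 := by
  simp only [boundary_bracket_eq_sum, map_sum, map_smul, Finset.smul_sum, smul_smul]
  rw [← Finset.sum_product']
  let P := Fin (p + 3) × Fin (p + 2)
  let S : Finset P := {ij : P | (ij.1 : ℕ) ≤ (ij.2 : ℕ)}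
  rw [Finset.univ_product_univ, ← Finset.sum_add_sum_compl S, ← eq_neg_iff_add_eq_zero,
    ← Finset.sum_neg_distrib]
  let φ : ∀ ij : P, ij ∈ S → P := fun ij hij =>
    (ij.2.succ, Fin.castLT ij.1 (lt_of_le_of_lt (Finset.mem_filter.mp hij).right ij.2.isLt))
  refine Finset.sum_bij φ ?_ ?_ ?_ ?_
  · intro ij hij
    simp_rw [S, φ, Finset.compl_filter, Finset.mem_filter_univ, Fin.val_succ,
      Fin.val_castLT] at hij ⊢
    lia
  · rintro ⟨i, j⟩ hij ⟨i', j'⟩ hij' h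
    have ha := congrArg (fun q : P => (q.1 : ℕ)) h
    have hb := congrArg (fun q : P => (q.2 : ℕ)) h
    simp only [φ, Fin.val_succ, Fin.val_castLT] at ha hb
    exact Prod.ext (Fin.ext hb) (Fin.ext (by lia))
  · rintro ⟨i', j'⟩ hij'
    simp_rw [S, Finset.compl_filter, Finset.mem_filter_univ, not_le] at hij'
    have h1 := i'.isLt
    have h2 := j'.isLt
    refine ⟨(j'.castSucc, ⟨i' - 1, by lia⟩), ?_, ?_⟩
    · simp only [S, Finset.mem_filter_univ, Fin.val_castSucc]
      lia
    · refine Prod.ext (Fin.ext ?_) (Fin.ext ?_)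
      · simp only [φ, Fin.val_succ]
        lia
      · simp only [φ, Fin.val_castLT, Fin.val_castSucc]
  · rintro ⟨i, j⟩ hij
    have hij' : (i : ℕ) ≤ j := by simpa only [S, Finset.mem_filter_univ] using hij
    simp only [φ, face_face B j i hij', ← neg_smul, Fin.val_succ, Fin.val_castLT]
    congr 1
    ring

/-- `∂_{r-1} ∘ ∂_r = 0`. -/
theorem boundary_boundary (c : Chain F H (p + 2)) :
    boundary F H p (boundary F H (p + 1) c) = 0 := by
  have h : boundary F H p ∘ₗ boundary F H (p + 1) = 0 := by
    apply Submodule.linearMap_qext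
    apply Finsupp.lhom_ext'
    intro B
    apply LinearMap.ext_ring
    exact boundary_boundary_bracket F B
  exact LinearMap.congr_fun h c

/-- The kernel of `∂_r`, `r = p - 1`; here `∂_{-1} = 0`. -/
noncomputable def cycles : (p : ℕ) → Submodule F (Chain F H p)
  | 0 => ⊤
  | p + 1 => LinearMap.ker (boundary F H p)

/-- `HC_r(Δ(H)) = ker ∂_r / im ∂_{r+1}`, `r = p - 1`. -/
abbrev HC : Type _ :=
  cycles F H p ⧸ (LinearMap.range (boundary F H p)).submoduleOf (cycles F H p)

variable {F H p} in
/-- The homology class of a cycle. -/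
noncomputable def homologyClass (z : cycles F H p) : HC F H p :=
  Submodule.Quotient.mk z

/-- The `k`-uniform hypergraph on `Fin n` whose hyperedges are all `k`-element subsets containing
the vertex `0`, which plays the role of the vertex `1` of `{1, …, n}`. -/
def vertexOne (n k : ℕ) [NeZero n] : Hypergraph (Fin n) where
  vertexSet := Set.univ
  edgeSet := {e | e.ncard = k ∧ (0 : Fin n) ∈ e}
  subset_vertexSet_of_mem_edgeSet' := fun _ _ => Set.subset_univ _

/-- The positions of the blocks of `(V ∖ {a_1, …, a_p}, {a_1}, …, {a_p})`. -/
noncomputable def singletonsIdx {n p : ℕ} (a : Fin p ↪ Fin n) (x : Fin n) : Fin (p + 1) :=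
  open Classical in if h : ∃ i, a i = x then h.choose.succ else 0

theorem singletonsIdx_apply {n p : ℕ} (a : Fin p ↪ Fin n) (i : Fin p) :
    singletonsIdx a (a i) = i.succ := by
  have h : ∃ j, a j = a i := ⟨i, rfl⟩
  rw [singletonsIdx, dif_pos h, a.injective h.choose_spec]

theorem singletonsIdx_of_notMem {n p : ℕ} (a : Fin p ↪ Fin n) (x : Fin n) (hx : ∀ i, a i ≠ x) :
    singletonsIdx a x = 0 := by
  rw [singletonsIdx, dif_neg (by simpa using hx)]

/-- The ordered partition `(V ∖ {a_1, …, a_p}, {a_1}, …, {a_p})`. -/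
noncomputable def singletonsFace {n k p : ℕ} [NeZero n] (hp : p + k ≤ n) (hk : 1 ≤ k)
    (a : Fin p ↪ Fin n) (ha : ∀ i, a i ≠ 0) : Face (vertexOne n k) p :=
  ⟨singletonsIdx a, by
    constructor
    · intro j
      refine Fin.cases ⟨0, singletonsIdx_of_notMem a 0 ha⟩ (fun i => ?_) j
      exact ⟨a i, singletonsIdx_apply a i⟩
    · have hc : ((Finset.univ.map a)ᶜ).card = n - p := by
        rw [Finset.card_compl, Finset.card_map, Finset.card_fin, Fintype.card_fin]
      obtain ⟨e, h0, he, hcard⟩ := Finset.exists_subsuperset_card_eq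
        (s := {(0 : Fin n)}) (t := (Finset.univ.map a)ᶜ) (n := k)
        (by simpa using ha) (by simpa using hk) (by rw [hc]; lia)
      refine ⟨e, ⟨by rw [Set.ncard_coe_finset, hcard], by simpa using h0⟩, 0, ?_⟩
      intro x hx
      refine singletonsIdx_of_notMem a x fun i hi => ?_
      have := he hx
      simp only [Finset.mem_compl, Finset.mem_map, Finset.mem_univ, true_and] at this
      exact this ⟨i, hi⟩⟩

/-- The subsets of `{2, …, n}` of size `n - r - 2`, where `r = p - 1`. -/
abbrev Index (n p : ℕ) [NeZero n] : Type :=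
  {A : Finset (Fin n) // 0 ∉ A ∧ A.card + (p + 1) = n}

theorem Index.card_compl {n p : ℕ} [NeZero n] (A : Index n p) :
    ((insert 0 A.1)ᶜ : Finset (Fin n)).card = p := by
  have := A.2.2
  rw [Finset.card_compl, Finset.card_insert_of_notMem A.2.1, Fintype.card_fin]
  lia

/-- The increasing enumeration `a_1 < ⋯ < a_p` of the complement of `A` in `{2, …, n}`. -/
def Index.enum {n p : ℕ} [NeZero n] (A : Index n p) : Fin p ↪ Fin n :=
  (((insert 0 A.1)ᶜ : Finset (Fin n)).orderEmbOfFin A.card_compl).toEmbedding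

theorem Index.enum_ne_zero {n p : ℕ} [NeZero n] (A : Index n p) (i : Fin p) : A.enum i ≠ 0 := by
  have h := Finset.orderEmbOfFin_mem ((insert 0 A.1)ᶜ : Finset (Fin n)) A.card_compl i
  intro h0
  rw [Finset.mem_compl, Finset.mem_insert, not_or] at h
  exact h.1 h0

/-- The chain `∑_σ sgn(σ) [A ∪ {1}, a_{σ(1)}, …, a_{σ(r+1)}]`, where `r = p - 1`. -/
noncomputable def representative (F : Type*) [Field F] {n k p : ℕ} [NeZero n] (hp : p + k ≤ n)
    (hk : 1 ≤ k) (A : Index n p) : Chain F (vertexOne n k) p :=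
  ∑ σ : Equiv.Perm (Fin p), ((Equiv.Perm.sign σ : ℤ) : F) •
    bracket F (singletonsFace hp hk (σ.toEmbedding.trans A.enum) fun i => A.enum_ne_zero (σ i))

end CyclicColoring

namespace CyclicColoring

/-! Every cyclic class has one representative with the vertex `0` in its first block. Rotating there
costs the sign (-1)^(p·j), where j is the position of the block of `0`; a full turn has sign
(-1)^(p(p+1)) = 1, so no class dies. Chains thus become the free space on ordered partitions whose
`0`-block has at least `k` elements (`normalForm_injective`, `exists_normalForm_eq`).

On this space the boundary is an inner part, which merges neighbouring blocks other than the
`0`-block, plus two terms which strictly enlarge the `0`-block. Filtering by the size of that block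
leaves only the inner part, and the graded complex is a direct sum over the complements T of the
`0`-block. Each summand is the complex of ordered partitions of T (the Coxeter complex of a
symmetric group, a sphere), with homology only in degree #T and there at most one-dimensional
(`exists_innerBoundary_eq`).

Spanning: climb the filtration. A leading term with #T ≠ p is an inner boundary and can be pushed to
a larger `0`-block; once #T = p, nothing lies deeper in the filtration, and the inner cycles on T
are the multiples of the antisymmetrized partition into singletons
(`exists_sub_totalBoundary_mem_span`).

Independence: read (B_0, …, B_p) as the differential form B_0 dB_1 ⋯ dB_p. Coefficients of such
forms kill boundaries (`formCoeff_totalBoundary`) and separate the antisymmetrizations, with value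
p! on the diagonal, which is nonzero in characteristic zero. -/

/-- A linear map sends chains supported on `s` into a submodule as soon as it does so on `s`. -/
theorem apply_mem_of_supported {F α N : Type*} [Field F] [AddCommGroup N] [Module F N]
    (L : (α →₀ F) →ₗ[F] N) (K : Submodule F N) {s : Set α}
    (h : ∀ f ∈ s, L (Finsupp.single f 1) ∈ K) {z : α →₀ F} (hz : z ∈ Finsupp.supported F F s) :
    L z ∈ K := by
  have : Finsupp.supported F F s ≤ K.comap L := by
    rw [Finsupp.supported_eq_span_single, Submodule.span_le]
    rintro _ ⟨f, hf, rfl⟩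
    exact h f hf
  exact this hz

/-! ### The inner complex of ordered partitions of T, and the splitting homotopy -/

section Internal

variable (F : Type*) [Field F] {V : Type*}

/-- Merge the blocks `i` and `i + 1`. -/
def mergeFun (i : ℕ) (f : V → ℕ) : V → ℕ := fun x => if i < f x then f x - 1 else f x

/-- The part of the boundary in degree `p` that does not change the block in position `0`. -/
noncomputable def innerBoundary (p : ℕ) : ((V → ℕ) →₀ F) →ₗ[F] ((V → ℕ) →₀ F) :=
  Finsupp.linearCombination F fun f =>
    ∑ i ∈ Ico 1 p, (-1 : F) ^ i • Finsupp.single (mergeFun i f) 1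

theorem innerBoundary_single (p : ℕ) (f : V → ℕ) :
    innerBoundary F p (Finsupp.single f 1) =
      ∑ i ∈ Ico 1 p, (-1 : F) ^ i • Finsupp.single (mergeFun i f) 1 := by
  rw [innerBoundary, Finsupp.linearCombination_single, one_smul]

/-- The ordered partitions with `p` nonempty blocks in positions `1, …, p` whose union is `T`. -/
def blocksOn (T : Finset V) (p : ℕ) : Set (V → ℕ) :=
  {f | (∀ x, f x ≤ p) ∧ (∀ i ≤ p, i ≠ 0 → ∃ x, f x = i) ∧ ∀ x, f x = 0 ↔ x ∉ T}

variable {F}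

theorem mergeFun_mem_blocksOn {T : Finset V} {p i : ℕ} {f : V → ℕ} (hf : f ∈ blocksOn T p)
    (hi : i ∈ Ico 1 p) : mergeFun i f ∈ blocksOn T (p - 1) := by
  obtain ⟨h1, h2, h3⟩ := hf
  rw [Finset.mem_Ico] at hi
  refine ⟨fun x => ?_, fun l hl hl0 => ?_, fun x => ?_⟩
  · have := h1 x
    unfold mergeFun
    grind
  · rcases le_or_gt l i with h | h
    · obtain ⟨x, hx⟩ := h2 l (by lia) hl0
      exact ⟨x, by unfold mergeFun; grind⟩
    · obtain ⟨x, hx⟩ := h2 (l + 1) (by lia) (by lia)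
      exact ⟨x, by unfold mergeFun; grind⟩
  · rw [← h3]
    unfold mergeFun
    grind

theorem innerBoundary_mem_supported {T : Finset V} {p : ℕ} {z : (V → ℕ) →₀ F}
    (hz : z ∈ Finsupp.supported F F (blocksOn T p)) :
    innerBoundary F p z ∈ Finsupp.supported F F (blocksOn T (p - 1)) := by
  refine apply_mem_of_supported _ _ (fun f hf => ?_) hz
  rw [innerBoundary_single]
  exact Submodule.sum_mem _ fun i hi => Submodule.smul_mem _ _
    (Finsupp.single_mem_supported F _ (mergeFun_mem_blocksOn hf hi))

variable [DecidableEq V] (F)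

/-- Make `v` a block of its own, to the left of the rest of its block. -/
def splitFun (v : V) (f : V → ℕ) : V → ℕ :=
  fun x => if x ≠ v ∧ f v ≤ f x then f x + 1 else f x

open Classical in
/-- The homotopy splitting `v` off its block. -/
noncomputable def splitHomotopy (v : V) : ((V → ℕ) →₀ F) →ₗ[F] ((V → ℕ) →₀ F) :=
  Finsupp.linearCombination F fun f =>
    if ∃ x, x ≠ v ∧ f x = f v then (-1 : F) ^ f v • Finsupp.single (splitFun v f) 1 else 0

/-- The last block, in position `p`, is `{v}`. -/
def IsLastSingleton (v : V) (p : ℕ) (f : V → ℕ) : Prop := f v = p ∧ ∀ x, f x = p → x = v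

open Classical in
/-- Project to the ordered partitions with last block `{v}`, and move `v` to position `0`. -/
noncomputable def removeLast (v : V) (p : ℕ) : ((V → ℕ) →₀ F) →ₗ[F] ((V → ℕ) →₀ F) :=
  Finsupp.linearCombination F fun f =>
    if IsLastSingleton v p f then Finsupp.single (Function.update f v 0) 1 else 0

variable {F}

theorem splitHomotopy_single_of_exists {v : V} {f : V → ℕ} (h : ∃ x, x ≠ v ∧ f x = f v) :
    splitHomotopy F v (Finsupp.single f 1) =
      (-1 : F) ^ f v • Finsupp.single (splitFun v f) 1 := by
  rw [splitHomotopy, Finsupp.linearCombination_single, one_smul, if_pos h]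

theorem splitHomotopy_single_of_not_exists {v : V} {f : V → ℕ}
    (h : ¬ ∃ x, x ≠ v ∧ f x = f v) : splitHomotopy F v (Finsupp.single f 1) = 0 := by
  rw [splitHomotopy, Finsupp.linearCombination_single, one_smul, if_neg h]

theorem removeLast_single_of_pos {v : V} {p : ℕ} {f : V → ℕ} (h : IsLastSingleton v p f) :
    removeLast F v p (Finsupp.single f 1) = Finsupp.single (Function.update f v 0) 1 := by
  rw [removeLast, Finsupp.linearCombination_single, one_smul, if_pos h]

theorem removeLast_single_of_neg {v : V} {p : ℕ} {f : V → ℕ} (h : ¬ IsLastSingleton v p f) :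
    removeLast F v p (Finsupp.single f 1) = 0 := by
  rw [removeLast, Finsupp.linearCombination_single, one_smul, if_neg h]

theorem splitFun_mem_blocksOn {T : Finset V} {v : V} (hv : v ∈ T) {p : ℕ} {f : V → ℕ}
    (hf : f ∈ blocksOn T p) (h : ∃ x, x ≠ v ∧ f x = f v) : splitFun v f ∈ blocksOn T (p + 1) := by
  obtain ⟨h1, h2, h3⟩ := hf
  have hv0 : f v ≠ 0 := fun h => (h3 v).1 h hv
  refine ⟨fun x => ?_, fun l hl hl0 => ?_, fun x => ?_⟩
  · have := h1 x
    unfold splitFun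
    grind
  · rcases lt_trichotomy l (f v) with h | h | h
    · obtain ⟨x, hx⟩ := h2 l (by have := h1 v; lia) hl0
      exact ⟨x, by unfold splitFun; grind⟩
    · exact ⟨v, by unfold splitFun; grind⟩
    · by_cases hl' : l = f v + 1
      · obtain ⟨x, hx⟩ := ‹∃ x, x ≠ v ∧ f x = f v›
        exact ⟨x, by unfold splitFun; grind⟩
      · obtain ⟨x, hx⟩ := h2 (l - 1) (by lia) (by lia)
        exact ⟨x, by unfold splitFun; grind⟩
  · rw [← h3]
    unfold splitFun
    grind

theorem splitHomotopy_mem_supported {T : Finset V} {v : V} (hv : v ∈ T) {p : ℕ}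
    {z : (V → ℕ) →₀ F} (hz : z ∈ Finsupp.supported F F (blocksOn T p)) :
    splitHomotopy F v z ∈ Finsupp.supported F F (blocksOn T (p + 1)) := by
  refine apply_mem_of_supported _ _ (fun f hf => ?_) hz
  by_cases h : ∃ x, x ≠ v ∧ f x = f v
  · rw [splitHomotopy_single_of_exists h]
    exact Submodule.smul_mem _ _
      (Finsupp.single_mem_supported F _ (splitFun_mem_blocksOn hv hf h))
  · rw [splitHomotopy_single_of_not_exists h]
    exact Submodule.zero_mem _

/-- Cancellation pattern of a homotopy identity Dh + hD - 1: terms left of the pivot `j` pair at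
equal indices up to an error in `L`, terms right of it pair with a shift by one, and the pivot gives
the identity. -/
theorem sum_add_sum_sub_mem {N : Type*} [AddCommGroup N] [Module F N] (L : Submodule F N)
    {p j : ℕ} (hj : 1 ≤ j) (hjp : j ≤ p) (a b : ℕ → N) (c : N)
    (h1 : ∀ i, 1 ≤ i → i < j → a i + b i ∈ L) (h2 : ∀ i, j ≤ i → i < p → a (i + 1) + b i = 0)
    (h3 : a j = c) : ∑ i ∈ Ico 1 (p + 1), a i + ∑ i ∈ Ico 1 p, b i - c ∈ L := by
  have e1 := Finset.sum_Ico_consecutive a hj (show j ≤ p + 1 by lia)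
  have e2 := Finset.sum_Ico_consecutive b hj hjp
  have e3 : ∑ i ∈ Ico j (p + 1), a i = a j + ∑ i ∈ Ico (j + 1) (p + 1), a i :=
    Finset.sum_eq_sum_Ico_succ_bot (by lia) a
  have e4 : ∑ i ∈ Ico (j + 1) (p + 1), a i = ∑ i ∈ Ico j p, a (i + 1) :=
    (Finset.sum_Ico_add' a j p 1).symm
  have e5 : ∑ i ∈ Ico j p, a (i + 1) + ∑ i ∈ Ico j p, b i = 0 := by
    rw [← Finset.sum_add_distrib]
    exact Finset.sum_eq_zero fun i hi => h2 i (Finset.mem_Ico.1 hi).1 (Finset.mem_Ico.1 hi).2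
  have e6 : ∑ i ∈ Ico 1 j, a i + ∑ i ∈ Ico 1 j, b i ∈ L := by
    rw [← Finset.sum_add_distrib]
    exact Submodule.sum_mem _ fun i hi => h1 i (Finset.mem_Ico.1 hi).1 (Finset.mem_Ico.1 hi).2
  convert e6 using 1
  rw [← e1, ← e2, e3, e4, h3, eq_neg_of_add_eq_zero_left e5]
  abel

theorem neg_one_pow_smul_add_eq_zero {N : Type*} [AddCommGroup N] [Module F N] {a b : ℕ} {x y : N}
    (h : x = y) (hab : a = b + 1) : (-1 : F) ^ a • x + (-1 : F) ^ b • y = 0 := by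
  rw [h, hab, pow_succ, mul_neg_one, neg_smul, neg_add_cancel]

/-- Up to ordered partitions with `v` further to the left, splitting off `v` is a contracting
homotopy away from the ordered partitions with last block `{v}`. -/
theorem innerBoundary_splitHomotopy_add {T : Finset V} {v : V} (hv : v ∈ T) {p : ℕ} {f : V → ℕ}
    (hf : f ∈ blocksOn T p) (hl : ¬ IsLastSingleton v p f) :
    innerBoundary F (p + 1) (splitHomotopy F v (Finsupp.single f 1)) +
      splitHomotopy F v (innerBoundary F p (Finsupp.single f 1)) - Finsupp.single f 1 ∈
        Finsupp.supported F F {g | g ∈ blocksOn T p ∧ g v < f v} := by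
  have hf' := hf
  obtain ⟨h1, h2, h3⟩ := hf'
  have hv0 : f v ≠ 0 := fun h => (h3 v).1 h hv
  have hvp := h1 v
  rw [innerBoundary_single, map_sum]
  simp only [map_smul]
  have hexm : ∀ i ∈ Ico 1 p, i + 1 = f v → ∃ x, x ≠ v ∧ mergeFun i f x = mergeFun i f v := by
    intro i hi hiv
    rw [Finset.mem_Ico] at hi
    obtain ⟨x, hx⟩ := h2 i (by lia) (by lia)
    exact ⟨x, by rintro rfl; lia, by unfold mergeFun; grind⟩
  -- The source of the errors: merging the block of `v` with its left neighbour and splitting `v`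
  -- off again puts `v` one position further left.
  have hlow : ∀ i ∈ Ico 1 p, i + 1 = f v →
      (-1 : F) ^ i • splitHomotopy F v (Finsupp.single (mergeFun i f) 1) ∈
        Finsupp.supported F F {g | g ∈ blocksOn T p ∧ g v < f v} := by
    intro i hi hiv
    have hm := mergeFun_mem_blocksOn hf hi
    have hex := hexm i hi hiv
    rw [splitHomotopy_single_of_exists hex]
    refine Submodule.smul_mem _ _ (Submodule.smul_mem _ _ (Finsupp.single_mem_supported F _ ?_))
    have hs := splitFun_mem_blocksOn hv hm hex
    rw [Finset.mem_Ico] at hi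
    rw [Nat.sub_add_cancel (by lia)] at hs
    refine ⟨hs, ?_⟩
    unfold splitFun mergeFun
    grind
  by_cases hex : ∃ x, x ≠ v ∧ f x = f v
  · rw [splitHomotopy_single_of_exists hex, map_smul, innerBoundary_single, Finset.smul_sum]
    have hs := splitFun_mem_blocksOn hv hf hex
    -- The pivot `f v` merges `v` back into the rest of its block. The shift to the right of it
    -- comes from the extra block created by the splitting.
    refine sum_add_sum_sub_mem _ (Nat.one_le_iff_ne_zero.2 hv0) hvp _ _ _ ?_ ?_ ?_
    · intro i hi hij
      have hi' : i ∈ Ico 1 p := by rw [Finset.mem_Ico]; lia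
      by_cases hiv : i + 1 = f v
      · refine Submodule.add_mem _ ?_ (hlow i hi' hiv)
        refine Submodule.smul_mem _ _ (Submodule.smul_mem _ _ (Finsupp.single_mem_supported F _ ?_))
        refine ⟨mergeFun_mem_blocksOn hs (by rw [Finset.mem_Ico]; lia), ?_⟩
        unfold splitFun mergeFun
        grind
      · have hex' : ∃ x, x ≠ v ∧ mergeFun i f x = mergeFun i f v := by
          obtain ⟨x, hx, hxv⟩ := hex
          exact ⟨x, hx, by unfold mergeFun; rw [hxv]⟩
        have hmv : mergeFun i f v + 1 = f v := by unfold mergeFun; grind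
        rw [splitHomotopy_single_of_exists hex', smul_smul, smul_smul, ← pow_add, ← pow_add]
        rw [neg_one_pow_smul_add_eq_zero]
        · exact Submodule.zero_mem _
        · congr 1
          funext x
          unfold splitFun mergeFun
          grind
        · lia
    · intro i hij hip
      have hex' : ∃ x, x ≠ v ∧ mergeFun i f x = mergeFun i f v := by
        obtain ⟨x, hx, hxv⟩ := hex
        exact ⟨x, hx, by unfold mergeFun; rw [hxv]⟩
      have hmv : mergeFun i f v = f v := by unfold mergeFun; grind
      rw [splitHomotopy_single_of_exists hex', smul_smul, smul_smul, ← pow_add, ← pow_add]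
      refine neg_one_pow_smul_add_eq_zero ?_ (by lia)
      congr 1
      funext x
      unfold splitFun mergeFun
      grind
    · rw [smul_smul, ← pow_add, Even.neg_one_pow ⟨_, rfl⟩, one_smul]
      congr 1
      funext x
      unfold splitFun mergeFun
      grind
  · rw [splitHomotopy_single_of_not_exists hex, map_zero, zero_add]
    -- Here `{v}` is a block but not the last one: merging it with its right neighbour and then
    -- splitting `v` off restores `f`, so the term `i = f v` gives the identity.
    have hvlt : f v < p := by
      refine lt_of_le_of_ne hvp fun h => hl ⟨h, fun x hx => ?_⟩
      by_contra hxv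
      exact hex ⟨x, hxv, by lia⟩
    have hmem : f v ∈ Ico 1 p := by rw [Finset.mem_Ico]; lia
    rw [← Finset.add_sum_erase _ _ hmem]
    have hexv : ∃ x, x ≠ v ∧ mergeFun (f v) f x = mergeFun (f v) f v := by
      obtain ⟨x, hx⟩ := h2 (f v + 1) (by lia) (by lia)
      exact ⟨x, by rintro rfl; lia, by unfold mergeFun; grind⟩
    have hmv : mergeFun (f v) f v = f v := by unfold mergeFun; grind
    have hmain : (-1 : F) ^ f v • splitHomotopy F v (Finsupp.single (mergeFun (f v) f) 1) =
        Finsupp.single f 1 := by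
      rw [splitHomotopy_single_of_exists hexv, smul_smul, ← pow_add, hmv,
        Even.neg_one_pow ⟨_, rfl⟩, one_smul]
      congr 1
      funext x
      have : x ≠ v → f x ≠ f v := fun h h' => hex ⟨x, h, h'⟩
      unfold splitFun mergeFun
      grind
    rw [hmain, add_sub_cancel_left]
    refine Submodule.sum_mem _ fun i hi => ?_
    rw [Finset.mem_erase] at hi
    by_cases hiv : i + 1 = f v
    · exact hlow i hi.2 hiv
    · have hex' : ¬ ∃ x, x ≠ v ∧ mergeFun i f x = mergeFun i f v := by
        rintro ⟨x, hx, hxv⟩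
        have : f x ≠ f v := fun h' => hex ⟨x, hx, h'⟩
        unfold mergeFun at hxv
        grind
      rw [splitHomotopy_single_of_not_exists hex', smul_zero]
      exact Submodule.zero_mem _

end Internal

/-! ### Homology of the ordered partitions of a set -/

section Acyclic

variable {F : Type*} [Field F] {V : Type*}

theorem mergeFun_mergeFun {i j : ℕ} (h : j < i) (f : V → ℕ) :
    mergeFun j (mergeFun i f) = mergeFun (i - 1) (mergeFun j f) := by
  funext x
  unfold mergeFun
  grind

theorem innerBoundary_innerBoundary (p : ℕ) (z : (V → ℕ) →₀ F) :
    innerBoundary F p (innerBoundary F (p + 1) z) = 0 := by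
  induction z using Finsupp.induction_linear with
  | zero => simp
  | add x y hx hy => rw [map_add, map_add, hx, hy, add_zero]
  | single f c =>
    suffices h : innerBoundary F p (innerBoundary F (p + 1) (Finsupp.single f 1)) = 0 by
      rw [← mul_one c, ← smul_eq_mul, ← Finsupp.smul_single, map_smul, map_smul, h, smul_zero]
    rw [innerBoundary_single, map_sum]
    simp only [map_smul, innerBoundary_single, Finset.smul_sum, smul_smul, ← pow_add]
    rw [← Finset.sum_product']
    -- The pairs (i, j) with j < i are matched with the others through `mergeFun_mergeFun`; the two
    -- exponents i + j differ by one.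
    refine Finset.sum_involution
      (fun a _ => if a.2 < a.1 then (a.2, a.1 - 1) else (a.2 + 1, a.1)) ?_ ?_ ?_ ?_
    · rintro ⟨i, j⟩ ha
      rw [Finset.mem_product, Finset.mem_Ico, Finset.mem_Ico] at ha
      dsimp only at ha ⊢
      split_ifs with h
      · refine neg_one_pow_smul_add_eq_zero ?_ (by dsimp only; lia)
        rw [mergeFun_mergeFun h]
      · rw [add_comm]
        refine neg_one_pow_smul_add_eq_zero ?_ (by dsimp only; lia)
        dsimp only
        rw [mergeFun_mergeFun (show i < j + 1 by lia), Nat.add_sub_cancel]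
    · rintro ⟨i, j⟩ ha - h
      dsimp only at h
      split_ifs at h <;> rw [Prod.ext_iff] at h <;> dsimp only at h <;> lia
    · rintro ⟨i, j⟩ ha
      rw [Finset.mem_product, Finset.mem_Ico, Finset.mem_Ico] at ha
      dsimp only at ha ⊢
      split_ifs with h <;> rw [Finset.mem_product, Finset.mem_Ico, Finset.mem_Ico] <;>
        dsimp only <;> lia
    · rintro ⟨i, j⟩ ha
      rw [Finset.mem_product, Finset.mem_Ico, Finset.mem_Ico] at ha
      dsimp only at ha ⊢
      by_cases h : j < i
      · rw [if_pos h]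
        dsimp only
        rw [if_neg (by lia)]
        ext <;> dsimp only
        lia
      · rw [if_neg h]
        dsimp only
        rw [if_pos (by lia)]
        ext <;> dsimp only
        lia

theorem blocksOn_disjoint {T : Finset V} {p q : ℕ} {f : V → ℕ} (hp : f ∈ blocksOn T p)
    (hq : f ∈ blocksOn T q) : p = q := by
  have key : ∀ {p q : ℕ}, f ∈ blocksOn T p → f ∈ blocksOn T q → p ≤ q := by
    intro p q hp hq
    by_cases h : p = 0
    · lia
    · obtain ⟨x, hx⟩ := hp.2.1 p le_rfl h
      rw [← hx]
      exact hq.1 x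
  exact le_antisymm (key hp hq) (key hq hp)

variable [DecidableEq V]

/-- The splitting homotopy contracts up to terms with `v` further left. For a cycle z, the error
Dh(z) - z is again a cycle, with a smaller bound on the position of `v`, so induction on that bound
applies. -/
theorem exists_innerBoundary_eq_of_not_isLastSingleton {T : Finset V} {v : V} (hv : v ∈ T) {p : ℕ}
    (j : ℕ) {z : (V → ℕ) →₀ F}
    (hz : z ∈ Finsupp.supported F F {f | f ∈ blocksOn T p ∧ ¬ IsLastSingleton v p f ∧ f v < j})
    (hdz : innerBoundary F p z = 0) :
    ∃ w ∈ Finsupp.supported F F (blocksOn T (p + 1)), innerBoundary F (p + 1) w = z := by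
  induction j generalizing z with
  | zero =>
    have h : {f : V → ℕ | f ∈ blocksOn T p ∧ ¬ IsLastSingleton v p f ∧ f v < 0} = ∅ := by
      ext; simp
    rw [h, Finsupp.supported_empty, Submodule.mem_bot] at hz
    exact ⟨0, Submodule.zero_mem _, by rw [map_zero, hz]⟩
  | succ j ih =>
    have hzT : z ∈ Finsupp.supported F F (blocksOn T p) :=
      Finsupp.supported_mono (fun f hf => hf.1) hz
    let L : ((V → ℕ) →₀ F) →ₗ[F] ((V → ℕ) →₀ F) :=
      innerBoundary F (p + 1) ∘ₗ splitHomotopy F v + splitHomotopy F v ∘ₗ innerBoundary F p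
        - LinearMap.id
    have hL : L z = innerBoundary F (p + 1) (splitHomotopy F v z) - z := by
      simp [L, hdz]
    have hLz : L z ∈ Finsupp.supported F F
        {f | f ∈ blocksOn T p ∧ ¬ IsLastSingleton v p f ∧ f v < j} := by
      refine apply_mem_of_supported L _ (fun f hf => ?_) hz
      refine Finsupp.supported_mono ?_ (innerBoundary_splitHomotopy_add hv hf.1 hf.2.1)
      intro g hg
      have h1 := hf.1.1 v
      have h2 := hg.2
      have h3 := hf.2.2
      exact ⟨hg.1, fun h => by have := h.1; lia, by lia⟩
    rw [hL] at hLz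
    obtain ⟨w, hw, hwz⟩ := ih hLz (by rw [map_sub, hdz, innerBoundary_innerBoundary, sub_zero])
    refine ⟨splitHomotopy F v z - w,
      Submodule.sub_mem _ (splitHomotopy_mem_supported hv hzT) hw, ?_⟩
    rw [map_sub, hwz, sub_sub_cancel]

theorem removeLast_apply {v : V} {p : ℕ} {g : V → ℕ} (hg : g v = 0)
    (hl : IsLastSingleton v p (Function.update g v p)) (z : (V → ℕ) →₀ F) :
    removeLast F v p z g = z (Function.update g v p) := by
  classical
  induction z using Finsupp.induction_linear with
  | zero => simp
  | add x y hx hy => rw [map_add, Finsupp.add_apply, Finsupp.add_apply, hx, hy]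
  | single f c =>
    rw [← mul_one c, ← smul_eq_mul, ← Finsupp.smul_single, map_smul, Finsupp.smul_apply,
      Finsupp.smul_apply]
    congr 1
    by_cases h : IsLastSingleton v p f
    · rw [removeLast_single_of_pos h, Finsupp.single_apply, Finsupp.single_apply]
      congr 1
      apply propext
      constructor
      · rintro rfl
        rw [Function.update_idem, ← h.1, Function.update_eq_self]
      · rintro rfl
        rw [Function.update_idem, ← hg, Function.update_eq_self]
    · rw [removeLast_single_of_neg h, Finsupp.single_apply, if_neg, Finsupp.zero_apply]
      rintro rfl
      exact h hl

theorem update_zero_mem_blocksOn {T : Finset V} {v : V} (hv : v ∉ T) {p : ℕ} {f : V → ℕ}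
    (hf : f ∈ blocksOn (insert v T) (p + 1)) (hl : IsLastSingleton v (p + 1) f) :
    Function.update f v 0 ∈ blocksOn T p := by
  obtain ⟨h1, h2, h3⟩ := hf
  refine ⟨fun x => ?_, fun l hl' hl0 => ?_, fun x => ?_⟩
  · have h4 := h1 x
    have h5 := hl.2 x
    by_cases h : x = v
    · rw [h, Function.update_self]; lia
    · rw [Function.update_of_ne h]
      have : f x ≠ p + 1 := fun h' => h (h5 h')
      lia
  · obtain ⟨x, hx⟩ := h2 l (by lia) hl0
    refine ⟨x, ?_⟩
    rw [Function.update_of_ne, hx]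
    rintro rfl
    have := hl.1
    lia
  · by_cases h : x = v
    · rw [h, Function.update_self]; simpa using hv
    · rw [Function.update_of_ne h, h3, Finset.mem_insert]; simp [h]

theorem update_mem_blocksOn {T : Finset V} {v : V} (hv : v ∉ T) {p : ℕ} {f : V → ℕ}
    (hf : f ∈ blocksOn T p) :
    Function.update f v (p + 1) ∈ blocksOn (insert v T) (p + 1) := by
  obtain ⟨h1, h2, h3⟩ := hf
  refine ⟨fun x => ?_, fun l hl' hl0 => ?_, fun x => ?_⟩
  · have h4 := h1 x
    by_cases h : x = v
    · rw [h, Function.update_self]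
    · rw [Function.update_of_ne h]
      lia
  · by_cases h : l = p + 1
    · exact ⟨v, by rw [h, Function.update_self]⟩
    · obtain ⟨x, hx⟩ := h2 l (by lia) hl0
      refine ⟨x, ?_⟩
      rw [Function.update_of_ne, hx]
      rintro rfl
      have := (h3 x).2 hv
      lia
  · by_cases h : x = v
    · rw [h, Function.update_self]; simp
    · rw [Function.update_of_ne h, h3, Finset.mem_insert]; simp [h]

theorem isLastSingleton_update {T : Finset V} (v : V) {p : ℕ} {f : V → ℕ}
    (hf : f ∈ blocksOn T p) : IsLastSingleton v (p + 1) (Function.update f v (p + 1)) := by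
  refine ⟨Function.update_self .., fun x hx => ?_⟩
  by_contra h
  rw [Function.update_of_ne h] at hx
  have := hf.1 x
  lia

theorem removeLast_mem_supported {T : Finset V} {v : V} (hv : v ∉ T) {p : ℕ}
    {z : (V → ℕ) →₀ F} (hz : z ∈ Finsupp.supported F F (blocksOn (insert v T) (p + 1))) :
    removeLast F v (p + 1) z ∈ Finsupp.supported F F (blocksOn T p) := by
  refine apply_mem_of_supported _ _ (fun f hf => ?_) hz
  by_cases h : IsLastSingleton v (p + 1) f
  · rw [removeLast_single_of_pos h]
    exact Finsupp.single_mem_supported F _ (update_zero_mem_blocksOn hv hf h)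
  · rw [removeLast_single_of_neg h]
    exact Submodule.zero_mem _

/-- `removeLast` is a chain map: the only merge that destroys a last block `{v}` is the final one,
and no merge can create such a block, because the last block of `f` always ends inside the last
block of the result. -/
theorem removeLast_innerBoundary {T : Finset V} {v : V} {p : ℕ}
    {z : (V → ℕ) →₀ F} (hz : z ∈ Finsupp.supported F F (blocksOn T (p + 1))) :
    removeLast F v p (innerBoundary F (p + 1) z) =
      innerBoundary F p (removeLast F v (p + 1) z) := by
  rw [← sub_eq_zero]
  refine (Submodule.mem_bot F).1 (apply_mem_of_supported
    (removeLast F v p ∘ₗ innerBoundary F (p + 1) - innerBoundary F p ∘ₗ removeLast F v (p + 1)) _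
    (fun f hf => ?_) hz)
  obtain ⟨h1, h2, h3⟩ := hf
  rw [Submodule.mem_bot, LinearMap.sub_apply, LinearMap.comp_apply, LinearMap.comp_apply,
    sub_eq_zero, innerBoundary_single, map_sum]
  simp only [map_smul]
  by_cases h : IsLastSingleton v (p + 1) f
  · rw [removeLast_single_of_pos h, innerBoundary_single]
    obtain ⟨hvp, hu⟩ := h
    symm
    refine Finset.sum_subset_zero_on_sdiff (Finset.Ico_subset_Ico_right p.le_succ) ?_ ?_
    · intro i hi
      rw [Finset.mem_sdiff, Finset.mem_Ico, Finset.mem_Ico] at hi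
      have hip : i = p := by lia
      rw [removeLast_single_of_neg, smul_zero]
      rintro ⟨-, hl⟩
      obtain ⟨x, hx⟩ := h2 p (by lia) (by lia)
      have := hl x (by unfold mergeFun; grind)
      rw [this] at hx
      lia
    · intro i hi
      rw [Finset.mem_Ico] at hi
      rw [removeLast_single_of_pos]
      · congr 2
        funext x
        by_cases hx : x = v
        · rw [hx]
          unfold mergeFun
          simp
        · unfold mergeFun
          simp [hx]
      · refine ⟨by unfold mergeFun; grind, fun x hx => hu x ?_⟩
        have := h1 x
        unfold mergeFun at hx
        grind
  · rw [removeLast_single_of_neg h, map_zero]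
    refine Finset.sum_eq_zero fun i hi => ?_
    rw [Finset.mem_Ico] at hi
    rw [removeLast_single_of_neg, smul_zero]
    rintro ⟨hmv, hl⟩
    obtain ⟨y, hy⟩ := h2 (p + 1) le_rfl (by lia)
    have hvy : ∀ y, f y = p + 1 → y = v := fun y hy => hl y (by unfold mergeFun; grind)
    exact h ⟨by rw [← hvy y hy, hy], hvy⟩

/-- The homology of the ordered partitions of `T` is concentrated in the top degree `#T`, where it
is at most one-dimensional. -/
theorem exists_innerBoundary_eq (T : Finset V) :
    ∃ g : V → ℕ, g ∈ blocksOn T T.card ∧ ∀ (p : ℕ) (z : (V → ℕ) →₀ F),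
      z ∈ Finsupp.supported F F (blocksOn T p) → innerBoundary F p z = 0 → z g = 0 →
      ∃ w ∈ Finsupp.supported F F (blocksOn T (p + 1)), innerBoundary F (p + 1) w = z := by
  -- Adding `v` to T shifts homology up one degree: `removeLast` maps onto the complex of T and its
  -- kernel is acyclic. The single coefficient at `g` encodes that the top homology is at most
  -- one-dimensional.
  induction T using Finset.induction_on with
  | empty =>
    refine ⟨0, ⟨by simp, by simp, by simp⟩, fun p z hz hdz hg => ?_⟩
    have : z = 0 := by
      ext f
      by_cases hf : f ∈ blocksOn (∅ : Finset V) p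
      · have : f = 0 := by
          funext x
          exact (hf.2.2 x).2 (by simp)
        rw [this, hg, Finsupp.zero_apply]
      · exact Finsupp.notMem_support_iff.1 fun h => hf (hz h)
    exact ⟨0, Submodule.zero_mem _, by rw [this, map_zero]⟩
  | insert v T hv ih =>
    obtain ⟨g, hgm, hg⟩ := ih
    have hgv : g v = 0 := (hgm.2.2 v).2 hv
    refine ⟨Function.update g v (T.card + 1), ?_, fun p z hz hdz hzg => ?_⟩
    · rw [Finset.card_insert_of_notMem hv]
      exact update_mem_blocksOn hv hgm
    have hvT := Finset.mem_insert_self v T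
    rcases p with _ | q
    · have : z = 0 := by
        ext f
        refine Finsupp.notMem_support_iff.1 fun h => ?_
        have hf : f ∈ blocksOn (insert v T) 0 := hz h
        exact (hf.2.2 v).1 (Nat.le_zero.1 (hf.1 v)) hvT
      exact ⟨0, Submodule.zero_mem _, by rw [this, map_zero]⟩
    have hy := removeLast_mem_supported hv hz
    obtain ⟨w, hw, hwy⟩ := hg q (removeLast F v (q + 1) z) hy
      (by rw [← removeLast_innerBoundary hz, hdz, map_zero]) (by
        -- In the top degree the coefficient at `g` is that of `z` at the extended partition; in
        -- other degrees `g` is not in the support.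
        by_cases hq : q = T.card
        · rw [hq, removeLast_apply hgv (isLastSingleton_update v hgm), hzg]
        · exact Finsupp.notMem_support_iff.1 fun h => hq (blocksOn_disjoint (hy h) hgm))
    -- Appending `{v}` as a last block is a section of `removeLast`; subtracting the boundary of `A
    -- w` from `z` leaves an element of the kernel.
    let A := Finsupp.lmapDomain F F fun f : V → ℕ => Function.update f v (q + 2)
    have hAw : A w ∈ Finsupp.supported F F (blocksOn (insert v T) (q + 2)) := by
      refine apply_mem_of_supported A _ (fun f hf => ?_) hw
      rw [Finsupp.lmapDomain_apply, Finsupp.mapDomain_single]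
      exact Finsupp.single_mem_supported F _ (update_mem_blocksOn hv hf)
    have hRA : removeLast F v (q + 2) (A w) = w := by
      rw [← sub_eq_zero]
      refine (Submodule.mem_bot F).1 (apply_mem_of_supported
        (removeLast F v (q + 2) ∘ₗ A - LinearMap.id) _ (fun f hf => ?_) hw)
      have hfv : f v = 0 := (hf.2.2 v).2 hv
      rw [Submodule.mem_bot, LinearMap.sub_apply, LinearMap.comp_apply, sub_eq_zero,
        Finsupp.lmapDomain_apply, Finsupp.mapDomain_single,
        removeLast_single_of_pos (isLastSingleton_update v hf), Function.update_idem, ← hfv,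
        Function.update_eq_self, LinearMap.id_apply]
    have hz' : z - innerBoundary F (q + 2) (A w) ∈
        Finsupp.supported F F (blocksOn (insert v T) (q + 1)) :=
      Submodule.sub_mem _ hz (innerBoundary_mem_supported hAw)
    have hRz' : removeLast F v (q + 1) (z - innerBoundary F (q + 2) (A w)) = 0 := by
      rw [map_sub, removeLast_innerBoundary hAw, hRA, hwy, sub_self]
    -- The bound `q + 2` imposes nothing, as positions are at most `q + 1`.
    obtain ⟨w', hw', hwz'⟩ := exists_innerBoundary_eq_of_not_isLastSingleton hvT (q + 2)
      (z := z - innerBoundary F (q + 2) (A w)) (by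
        intro f hf
        have hfm := hz' hf
        refine ⟨hfm, fun hl => ?_, by have := hfm.1 v; lia⟩
        have hff : Function.update (Function.update f v 0) v (q + 1) = f := by
          rw [Function.update_idem, ← hl.1, Function.update_eq_self]
        have := removeLast_apply (g := Function.update f v 0) (p := q + 1)
          (Function.update_self ..) (by rw [hff]; exact hl) (z - innerBoundary F (q + 2) (A w))
        rw [hRz', hff] at this
        exact Finsupp.mem_support_iff.1 hf this.symm)
      (by rw [map_sub, hdz, innerBoundary_innerBoundary, sub_zero])
    exact ⟨A w + w', Submodule.add_mem _ hAw hw', by rw [map_add, hwz', add_sub_cancel]⟩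

end Acyclic

/-! ### Cyclic chains as combinations of normalized partitions -/

section Transport

variable (F : Type*) [Field F]

/-- Merge the last block, in position `p`, into the block in position `0`. -/
def wrapFun {V : Type*} (p : ℕ) (f : V → ℕ) : V → ℕ := fun x => if f x < p then f x else 0

/-- The boundary from degree `p + 1` to degree `p`, on normalized ordered partitions. -/
noncomputable def totalBoundary {V : Type*} (p : ℕ) : ((V → ℕ) →₀ F) →ₗ[F] ((V → ℕ) →₀ F) :=
  Finsupp.linearCombination F fun f =>
    ∑ i : Fin (p + 1), (-1 : F) ^ (i : ℕ) • Finsupp.single (mergeFun i f) 1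
      + (-1 : F) ^ (p + 1) • Finsupp.single (wrapFun (p + 1) f) 1

theorem totalBoundary_single {V : Type*} (p : ℕ) (f : V → ℕ) :
    totalBoundary F p (Finsupp.single f 1) =
      ∑ i : Fin (p + 1), (-1 : F) ^ (i : ℕ) • Finsupp.single (mergeFun i f) 1
      + (-1 : F) ^ (p + 1) • Finsupp.single (wrapFun (p + 1) f) 1 := by
  rw [totalBoundary, Finsupp.linearCombination_single, one_smul]

variable {n : ℕ} [NeZero n]

/-- The ordered partitions into `p + 1` nonempty blocks with the vertex `0` in the first block, which
has at least `m` elements. -/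
def normalizedFaces (n : ℕ) [NeZero n] (p m : ℕ) : Set (Fin n → ℕ) :=
  {f | f 0 = 0 ∧ (∀ x, f x ≤ p) ∧ (∀ i ≤ p, ∃ x, f x = i) ∧ m ≤ (univ.filter fun x => f x = 0).card}

/-- The blocks of a face, rotated so that the vertex `0` lies in the first one. -/
def Face.normalize {H : Hypergraph (Fin n)} {p : ℕ} (B : Face H p) : Fin n → ℕ :=
  fun x => ((B.1 x - B.1 0 : Fin (p + 1)) : ℕ)

variable {F} in
-- Makes the sign of `normalForm` compatible with the cyclic relation. When position 0 wraps around
-- to p, the total sign is trivial because p(p+1) is even.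
theorem neg_one_pow_mul_sub_one {p : ℕ} (j : Fin (p + 1)) :
    (-1 : F) ^ (p * (j : ℕ)) = (-1 : F) ^ p * (-1 : F) ^ (p * ((j - 1 : Fin (p + 1)) : ℕ)) := by
  rw [sub_one_val, ← pow_add]
  split_ifs with h
  · rw [h, mul_zero, pow_zero, show p + p * p = p * (p + 1) by ring,
      (Nat.even_mul_succ_self p).neg_one_pow]
  · congr 1
    obtain ⟨i, hi⟩ := Nat.exists_eq_succ_of_ne_zero h
    rw [hi, Nat.succ_sub_one, Nat.mul_succ, add_comm]

/-- Chains as combinations of normalized ordered partitions. -/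
noncomputable def normalForm (H : Hypergraph (Fin n)) (p : ℕ) :
    Chain F H p →ₗ[F] ((Fin n → ℕ) →₀ F) :=
  (cyclicRel F H p).liftQ
    (Finsupp.linearCombination F fun B : Face H p =>
      (-1 : F) ^ (p * (B.1 0 : ℕ)) • Finsupp.single B.normalize 1) (by
    refine Submodule.span_le.2 ?_
    rintro _ ⟨B, rfl⟩
    rw [SetLike.mem_coe, LinearMap.mem_ker, map_sub, map_smul, Finsupp.linearCombination_single,
      Finsupp.linearCombination_single, one_smul, one_smul, sub_eq_zero, smul_smul,
      neg_one_pow_mul_sub_one]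
    congr 2
    funext x
    simp only [Face.normalize, Face.rotate, Face.map, Function.comp_apply, sub_sub_sub_cancel_right])

variable {F} {H : Hypergraph (Fin n)} {p : ℕ}

theorem normalForm_bracket {B : Face H p} (hB : B.1 0 = 0) :
    normalForm F H p (bracket F B) = Finsupp.single (fun x => (B.1 x : ℕ)) 1 := by
  have h : normalForm F H p (bracket F B) =
      Finsupp.linearCombination F (fun B : Face H p =>
        (-1 : F) ^ (p * (B.1 0 : ℕ)) • Finsupp.single B.normalize 1) (Finsupp.single B 1) :=
    Submodule.liftQ_apply _ _ _
  rw [h, Finsupp.linearCombination_single, one_smul, hB]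
  simp only [Fin.val_zero, mul_zero, pow_zero, one_smul]
  congr 1
  funext x
  rw [Face.normalize, hB, sub_zero]

theorem exists_bracket_eq_smul (B : Face H p) :
    ∃ B' : Face H p, B'.1 0 = 0 ∧ ∃ c : F, bracket F B = c • bracket F B' := by
  induction h : (B.1 0 : ℕ) generalizing B with
  | zero => exact ⟨B, Fin.ext h, 1, (one_smul _ _).symm⟩
  | succ j ih =>
    obtain ⟨B', h0, c, hc⟩ := ih B.rotate (by
      simp only [Face.rotate, Face.map, Function.comp_apply, sub_one_val]
      lia)
    exact ⟨B', h0, (-1 : F) ^ p * c, by rw [bracket_rotate, hc, smul_smul]⟩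

theorem span_bracket_eq_top :
    Submodule.span F {c : Chain F H p | ∃ B : Face H p, B.1 0 = 0 ∧ bracket F B = c} = ⊤ := by
  rw [eq_top_iff]
  rintro c -
  obtain ⟨c, rfl⟩ := Submodule.mkQ_surjective _ c
  induction c using Finsupp.induction_linear with
  | zero => rw [map_zero]; exact Submodule.zero_mem _
  | add x y hx hy => rw [map_add]; exact Submodule.add_mem _ hx hy
  | single B a =>
    obtain ⟨B', h0, c, hc⟩ := exists_bracket_eq_smul (F := F) B
    have : (cyclicRel F H p).mkQ (Finsupp.single B a) = (a * c) • bracket F B' := by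
      rw [← mul_one a, ← smul_eq_mul, ← Finsupp.smul_single, map_smul, ← bracket, hc, smul_smul,
        smul_eq_mul, mul_one]
    rw [this]
    exact Submodule.smul_mem _ _ (Submodule.subset_span ⟨B', h0, rfl⟩)

theorem chain_hom_ext {N : Type*} [AddCommGroup N] [Module F N] {f g : Chain F H p →ₗ[F] N}
    (h : ∀ B : Face H p, B.1 0 = 0 → f (bracket F B) = g (bracket F B)) : f = g := by
  refine LinearMap.ext_on span_bracket_eq_top ?_
  rintro _ ⟨B, hB, rfl⟩
  exact h B hB

theorem normalForm_injective : Function.Injective (normalForm F H p) := by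
  classical
  let Ψ : ((Fin n → ℕ) →₀ F) →ₗ[F] Chain F H p := Finsupp.linearCombination F fun f =>
    if h : ∃ B : Face H p, B.1 0 = 0 ∧ (fun x => (B.1 x : ℕ)) = f then bracket F h.choose else 0
  have h : Ψ ∘ₗ normalForm F H p = LinearMap.id := by
    refine chain_hom_ext fun B hB => ?_
    have hex : ∃ B' : Face H p, B'.1 0 = 0 ∧ (fun x => (B'.1 x : ℕ)) = fun x => (B.1 x : ℕ) :=
      ⟨B, hB, rfl⟩
    rw [LinearMap.comp_apply, normalForm_bracket hB, Finsupp.linearCombination_single, one_smul,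
      dif_pos hex, LinearMap.id_apply]
    congr 1
    apply Subtype.ext
    funext x
    exact Fin.ext (congrFun hex.choose_spec.2 x)
  exact Function.LeftInverse.injective (g := Ψ) fun c => LinearMap.congr_fun h c

theorem normalForm_boundary (c : Chain F H (p + 1)) :
    normalForm F H p (boundary F H p c) = totalBoundary F p (normalForm F H (p + 1) c) := by
  have h : normalForm F H p ∘ₗ boundary F H p = totalBoundary F p ∘ₗ normalForm F H (p + 1) := by
    refine chain_hom_ext fun B hB => ?_
    rw [LinearMap.comp_apply, LinearMap.comp_apply, normalForm_bracket hB, totalBoundary_single,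
      boundary_bracket, map_add, map_sum, map_smul]
    congr 1
    · refine Finset.sum_congr rfl fun i _ => ?_
      rw [map_smul, normalForm_bracket]
      · congr 2
        funext x
        simp only [Face.merge, Face.map, Function.comp_apply, predAbove_val, mergeFun]
      · apply Fin.ext
        simp only [Face.merge, Face.map, Function.comp_apply, predAbove_val, hB]
        simp
    · rw [normalForm_bracket]
      · congr 2
        funext x
        simp only [Face.wrap, Face.map, Function.comp_apply, wrapIdx_val, wrapFun]
      · apply Fin.ext
        simp only [Face.wrap, Face.map, Function.comp_apply, wrapIdx_val, hB]
        simp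
  exact LinearMap.congr_fun h c

theorem mem_normalizedFaces {k : ℕ} {B : Face (vertexOne n k) p} (hB : B.1 0 = 0) :
    (fun x => (B.1 x : ℕ)) ∈ normalizedFaces n p k := by
  obtain ⟨B, hs, e, ⟨rfl, h0e⟩, i, hi⟩ := B
  dsimp only at hB
  refine ⟨by simp [hB], fun x => Nat.lt_succ_iff.1 (B x).isLt, fun i hi => ?_, ?_⟩
  · obtain ⟨x, hx⟩ := hs ⟨i, Nat.lt_succ_iff.2 hi⟩
    exact ⟨x, by simp [hx]⟩
  · have hi0 : i = 0 := by rw [← hB]; exact (hi h0e).symm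
    rw [← Set.ncard_coe_finset]
    refine Set.ncard_le_ncard (fun x hx => ?_) (Finset.finite_toSet _)
    have : B x = 0 := by rw [← hi0]; exact hi hx
    simp [this]

/-- A `k`-subset of the `0`-block containing `0` is a hyperedge; `1 ≤ k` leaves room for `0`. -/
theorem exists_face_of_mem_normalizedFaces {k : ℕ} (hk : 1 ≤ k) {f : Fin n → ℕ}
    (hf : f ∈ normalizedFaces n p k) :
    ∃ B : Face (vertexOne n k) p, B.1 0 = 0 ∧ (fun x => (B.1 x : ℕ)) = f := by
  obtain ⟨h0, h1, h2, h3⟩ := hf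
  obtain ⟨e, he0, he, hcard⟩ := Finset.exists_subsuperset_card_eq
    (s := {(0 : Fin n)}) (t := univ.filter fun x => f x = 0) (n := k)
    (by simpa using h0) (by simpa using hk) h3
  refine ⟨⟨fun x => ⟨f x, Nat.lt_succ_iff.2 (h1 x)⟩, fun j => ?_, e, ⟨?_, ?_⟩, 0, fun x hx => ?_⟩,
    Fin.ext h0, rfl⟩
  · obtain ⟨x, hx⟩ := h2 j (Nat.lt_succ_iff.1 j.isLt)
    exact ⟨x, Fin.ext hx⟩
  · rw [Set.ncard_coe_finset, hcard]
  · simpa using he0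
  · have := he hx
    rw [Finset.mem_filter] at this
    exact Fin.ext this.2

theorem normalForm_mem_supported {k : ℕ} (c : Chain F (vertexOne n k) p) :
    normalForm F (vertexOne n k) p c ∈ Finsupp.supported F F (normalizedFaces n p k) := by
  have h : c ∈ (⊤ : Submodule F (Chain F (vertexOne n k) p)) := trivial
  rw [← span_bracket_eq_top] at h
  refine (Submodule.span_le.2 ?_ :
    _ ≤ (Finsupp.supported F F (normalizedFaces n p k)).comap (normalForm F (vertexOne n k) p)) h
  rintro _ ⟨B, hB, rfl⟩
  rw [SetLike.mem_coe, Submodule.mem_comap, normalForm_bracket hB]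
  exact Finsupp.single_mem_supported F _ (mem_normalizedFaces hB)

theorem exists_normalForm_eq {k : ℕ} (hk : 1 ≤ k) {z : (Fin n → ℕ) →₀ F}
    (hz : z ∈ Finsupp.supported F F (normalizedFaces n p k)) :
    ∃ c, normalForm F (vertexOne n k) p c = z := by
  refine (apply_mem_of_supported LinearMap.id (LinearMap.range (normalForm F (vertexOne n k) p))
    (fun f hf => ?_) hz)
  obtain ⟨B, hB, rfl⟩ := exists_face_of_mem_normalizedFaces hk hf
  exact ⟨bracket F B, normalForm_bracket hB⟩

/-- Transported from `boundary_boundary`. As `k` is arbitrary here, it also serves at every level of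
the filtration. -/
theorem totalBoundary_totalBoundary {k : ℕ} (hk : 1 ≤ k) {z : (Fin n → ℕ) →₀ F}
    (hz : z ∈ Finsupp.supported F F (normalizedFaces n (p + 2) k)) :
    totalBoundary F p (totalBoundary F (p + 1) z) = 0 := by
  obtain ⟨c, rfl⟩ := exists_normalForm_eq hk hz
  rw [← normalForm_boundary, ← normalForm_boundary, boundary_boundary, map_zero]

end Transport

/-! ### Differential form coefficients as invariants of homology -/

section Determinant

/-- Let D t be the determinant with row t deleted. By additivity in row i, the i-th middle term is D
i + D (i+1) up to sign, and the alternating sum telescopes. -/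
theorem det_alternating_sum_eq_zero {R : Type*} [CommRing R] {p : ℕ}
    (r : Fin (p + 1) → Fin p → R) :
    (Matrix.of fun l : Fin p => r l.succ).det +
      ∑ i : Fin p, (-1 : R) ^ (i.succ : ℕ) * (Matrix.of fun l : Fin p =>
        if l < i then r l.castSucc else if l = i then r i.castSucc + r i.succ else r l.succ).det +
      (-1 : R) ^ (p + 1) * (Matrix.of fun l : Fin p => r l.castSucc).det = 0 := by
  let D : Fin (p + 1) → R := fun t => (Matrix.of fun l : Fin p => r (t.succAbove l)).det
  have h0 : (Matrix.of fun l : Fin p => r l.succ).det = D 0 := by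
    simp only [D, Fin.succAbove_zero]
  have hl : (Matrix.of fun l : Fin p => r l.castSucc).det = D (Fin.last p) := by
    simp only [D, Fin.succAbove_last]
  have hm : ∀ i : Fin p, (Matrix.of fun l : Fin p => if l < i then r l.castSucc else
      if l = i then r i.castSucc + r i.succ else r l.succ).det = D i.succ + D i.castSucc := by
    intro i
    set M : Matrix (Fin p) (Fin p) R := Matrix.of fun l : Fin p => if l < i then r l.castSucc else
      if l = i then r i.castSucc + r i.succ else r l.succ with hM
    have e : M = M.updateRow i (r i.castSucc + r i.succ) := by
      symm
      convert Matrix.updateRow_eq_self M i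
      funext m
      rw [hM, Matrix.of_apply, if_neg (lt_irrefl i), if_pos rfl]
    have e1 : M.updateRow i (r i.castSucc) = Matrix.of fun l => r (i.succ.succAbove l) := by
      ext l m
      rw [Matrix.updateRow_apply, Matrix.of_apply]
      rcases lt_trichotomy l i with h | h | h
      · rw [if_neg h.ne, Fin.succAbove_of_castSucc_lt _ _ (by rw [Fin.lt_def] at h ⊢; simp; lia)]
        simp [hM, h]
      · rw [if_pos h, h, Fin.succAbove_of_castSucc_lt _ _ (by simp)]
      · rw [if_neg h.ne', Fin.succAbove_of_le_castSucc _ _ (by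
          rw [Fin.lt_def] at h; rw [Fin.le_def]; simp; lia)]
        simp [hM, h.not_gt, h.ne']
    have e2 : M.updateRow i (r i.succ) = Matrix.of fun l => r (i.castSucc.succAbove l) := by
      ext l m
      rw [Matrix.updateRow_apply, Matrix.of_apply]
      rcases lt_trichotomy l i with h | h | h
      · rw [if_neg h.ne, Fin.succAbove_of_castSucc_lt _ _ (by simpa using h)]
        simp [hM, h]
      · rw [if_pos h, h, Fin.succAbove_of_le_castSucc _ _ le_rfl]
      · rw [if_neg h.ne', Fin.succAbove_of_le_castSucc _ _ (by simpa using h.le)]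
        simp [hM, h.not_gt, h.ne']
    rw [e, Matrix.det_updateRow_add, e1, e2]
  simp only [h0, hl, hm]
  have s1 := Fin.sum_univ_succ fun t : Fin (p + 1) => (-1 : R) ^ (t : ℕ) * D t
  have s2 := Fin.sum_univ_castSucc fun t : Fin (p + 1) => (-1 : R) ^ (t : ℕ) * D t
  simp only [mul_add, Finset.sum_add_distrib]
  have s3 : ∑ i : Fin p, (-1 : R) ^ (i.succ : ℕ) * D i.castSucc =
      - ∑ i : Fin p, (-1 : R) ^ (i.castSucc : ℕ) * D i.castSucc := by
    rw [← Finset.sum_neg_distrib]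
    refine Finset.sum_congr rfl fun i _ => ?_
    rw [Fin.val_succ, Fin.val_castSucc, pow_succ]
    ring
  simp only [Fin.val_zero, pow_zero, one_mul, Fin.val_last] at s1 s2
  rw [s3, pow_succ]
  linear_combination s2 - s1

variable (F : Type*) [Field F] {V : Type*} {p : ℕ}

/-- The coefficient of `da_1 ∧ ⋯ ∧ da_p` in the differential form `B_0 dB_1 ⋯ dB_p`. -/
noncomputable def formCoeff (a : Fin p → V) : ((V → ℕ) →₀ F) →ₗ[F] F :=
  Finsupp.linearCombination F fun f =>
    (Matrix.of fun i j : Fin p => if f (a j) = (i : ℕ) + 1 then (1 : F) else 0).det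

theorem formCoeff_single (a : Fin p → V) (f : V → ℕ) :
    formCoeff F a (Finsupp.single f 1) =
      (Matrix.of fun i j : Fin p => if f (a j) = (i : ℕ) + 1 then (1 : F) else 0).det := by
  rw [formCoeff, Finsupp.linearCombination_single, one_smul]

variable {F}

/-- The rows are the indicators of blocks 1, …, p+1 on the chosen vertices: merging two of these
blocks adds their rows, and absorbing the first or last into the `0`-block deletes a row. -/
theorem formCoeff_totalBoundary (a : Fin p → V) (z : (V → ℕ) →₀ F) :
    formCoeff F a (totalBoundary F p z) = 0 := by
  induction z using Finsupp.induction_linear with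
  | zero => simp
  | add x y hx hy => rw [map_add, map_add, hx, hy, add_zero]
  | single f c =>
    suffices h : formCoeff F a (totalBoundary F p (Finsupp.single f 1)) = 0 by
      rw [← mul_one c, ← smul_eq_mul, ← Finsupp.smul_single, map_smul, map_smul, h, smul_zero]
    rw [totalBoundary_single, map_add, map_sum, map_smul, Fin.sum_univ_succ]
    simp only [map_smul, formCoeff_single, smul_eq_mul, Fin.val_zero, pow_zero, one_mul]
    refine Eq.trans ?_ (det_alternating_sum_eq_zero fun (t : Fin (p + 1)) (j : Fin p) =>
      if f (a j) = (t : ℕ) + 1 then (1 : F) else 0)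
    congr 1
    · congr 1
      · congr 2
        ext i j
        congr 1
        apply propext
        rw [Fin.val_succ]
        unfold mergeFun
        grind
      · refine Finset.sum_congr rfl fun i _ => ?_
        congr 3
        ext l j
        dsimp only [Fin.val_succ, Fin.val_castSucc, mergeFun]
        rcases lt_trichotomy l i with h | h | h
        · rw [if_pos h]
          rw [Fin.lt_def] at h
          congr 1
          apply propext
          grind
        · subst h
          rw [if_neg (lt_irrefl _), if_pos rfl]
          simp only [Pi.add_apply]
          grind
        · rw [if_neg h.not_gt, if_neg h.ne']
          rw [Fin.lt_def] at h
          congr 1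
          apply propext
          grind
    · congr 3
      ext i j
      congr 1
      apply propext
      have := i.isLt
      rw [Fin.val_castSucc]
      unfold wrapFun
      grind

end Determinant

/-! ### The antisymmetrized cycles -/

section Representative

variable {F : Type*} [Field F] {n : ℕ}

theorem singletonsIdx_cases {p : ℕ} (a : Fin p ↪ Fin n) (τ : Equiv.Perm (Fin p)) (x : Fin n) :
    (∃ j, x = a (τ j) ∧ singletonsIdx (τ.toEmbedding.trans a) x = j.succ ∧
      singletonsIdx a x = (τ j).succ) ∨
    ((∀ j, a j ≠ x) ∧ singletonsIdx (τ.toEmbedding.trans a) x = 0 ∧ singletonsIdx a x = 0) := by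
  by_cases h : ∃ j, a j = x
  · obtain ⟨j, rfl⟩ := h
    refine Or.inl ⟨τ.symm j, by simp, ?_, ?_⟩
    · have := singletonsIdx_apply (τ.toEmbedding.trans a) (τ.symm j)
      simpa using this
    · rw [singletonsIdx_apply]; simp
  · push Not at h
    exact Or.inr ⟨h, singletonsIdx_of_notMem _ _ fun i => h _, singletonsIdx_of_notMem _ _ h⟩

theorem mergeFun_singletonsIdx_swap {q : ℕ} (a : Fin (q + 1) ↪ Fin n) (l : Fin q) :
    mergeFun (l + 1) (fun x => (singletonsIdx
      ((Equiv.swap l.castSucc l.succ).toEmbedding.trans a) x : ℕ)) =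
    mergeFun (l + 1) (fun x => (singletonsIdx a x : ℕ)) := by
  funext x
  obtain ⟨j, -, h1, h2⟩ | ⟨-, h1, h2⟩ := singletonsIdx_cases a (Equiv.swap l.castSucc l.succ) x
  · simp only [mergeFun, h1, h2, Fin.val_succ, Equiv.swap_apply_def]
    split_ifs <;> simp_all [Fin.ext_iff]
  · simp only [mergeFun, h1, h2]

/-- Absorbing the first singleton into the `0`-block equals absorbing the last one after a cyclic
rotation of the singletons. -/
theorem mergeFun_zero_singletonsIdx {q : ℕ} (a : Fin (q + 1) ↪ Fin n) :
    mergeFun 0 (fun x => (singletonsIdx a x : ℕ)) =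
    wrapFun (q + 1) (fun x => (singletonsIdx ((finRotate (q + 1)).toEmbedding.trans a) x : ℕ)) := by
  funext x
  obtain ⟨j, -, h1, h2⟩ | ⟨-, h1, h2⟩ := singletonsIdx_cases a (finRotate (q + 1)) x
  · have := j.isLt
    simp only [mergeFun, wrapFun, h1, h2, Fin.val_succ, coe_finRotate, Fin.ext_iff, Fin.val_last]
    grind
  · simp [mergeFun, wrapFun, h1, h2]

/-- The antisymmetrization of the ordered partition `(V ∖ {a_1, …, a_p}, {a_1}, …, {a_p})`. -/
noncomputable def antisymmetrization (F : Type*) [Field F] {p : ℕ} (a : Fin p ↪ Fin n) :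
    (Fin n → ℕ) →₀ F :=
  ∑ σ : Equiv.Perm (Fin p), ((Equiv.Perm.sign σ : ℤ) : F) •
    Finsupp.single (fun x => (singletonsIdx (σ.toEmbedding.trans a) x : ℕ)) 1

theorem sum_sign_smul_eq_zero {N ι : Type*} [AddCommGroup N] [Module F N] [Fintype ι]
    [DecidableEq ι] {i j : ι} (hij : i ≠ j) (Q : Equiv.Perm ι → N)
    (hQ : ∀ σ, Q (σ * Equiv.swap i j) = Q σ) :
    ∑ σ : Equiv.Perm ι, ((Equiv.Perm.sign σ : ℤ) : F) • Q σ = 0 := by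
  refine Finset.sum_involution (fun σ _ => σ * Equiv.swap i j) ?_ ?_ ?_ ?_
  · intro σ _
    rw [hQ, Equiv.Perm.sign_mul, Equiv.Perm.sign_swap hij]
    simp
  · intro σ _ _ h
    exact hij (Equiv.swap_eq_one_iff.1 (mul_eq_left.1 h))
  · intro σ _
    exact Finset.mem_univ _
  · intro σ _
    simp [mul_assoc]

/-- An inner merge does not see the transposition of the two merged singletons, so it cancels in the
signed sum. The two outer terms match under `finRotate`, whose sign (-1)^q against (-1)^(q+1) leaves
-1. -/
theorem totalBoundary_antisymmetrization {q : ℕ} (a : Fin (q + 1) ↪ Fin n) :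
    totalBoundary F q (antisymmetrization F a) = 0 := by
  have htrans : ∀ σ τ : Equiv.Perm (Fin (q + 1)), (σ * τ).toEmbedding.trans a =
      τ.toEmbedding.trans (σ.toEmbedding.trans a) := fun σ τ => rfl
  have hmid : ∀ l : Fin q, ∑ σ : Equiv.Perm (Fin (q + 1)), ((Equiv.Perm.sign σ : ℤ) : F) •
      Finsupp.single (mergeFun (l + 1)
        fun x => (singletonsIdx (σ.toEmbedding.trans a) x : ℕ)) (1 : F) = 0 := by
    intro l
    refine sum_sign_smul_eq_zero (i := l.castSucc) (j := l.succ) (by simp [Fin.ext_iff]) _ fun σ => ?_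
    rw [htrans, mergeFun_singletonsIdx_swap]
  have hwrap : ∑ σ : Equiv.Perm (Fin (q + 1)), ((Equiv.Perm.sign σ : ℤ) : F) •
      Finsupp.single (wrapFun (q + 1)
        fun x => (singletonsIdx (σ.toEmbedding.trans a) x : ℕ)) (1 : F) =
      (-1 : F) ^ q • ∑ σ : Equiv.Perm (Fin (q + 1)), ((Equiv.Perm.sign σ : ℤ) : F) •
      Finsupp.single (mergeFun 0
        fun x => (singletonsIdx (σ.toEmbedding.trans a) x : ℕ)) (1 : F) := by
    rw [← Equiv.sum_comp (Equiv.mulRight (finRotate (q + 1))), Finset.smul_sum]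
    refine Finset.sum_congr rfl fun σ _ => ?_
    rw [Equiv.coe_mulRight, htrans, ← mergeFun_zero_singletonsIdx, smul_smul, Equiv.Perm.sign_mul,
      sign_finRotate]
    congr 1
    push_cast
    ring
  rw [antisymmetrization, map_sum]
  simp only [map_smul, totalBoundary_single, smul_add, Finset.sum_add_distrib]
  have hcomm : ∑ σ : Equiv.Perm (Fin (q + 1)), ((Equiv.Perm.sign σ : ℤ) : F) •
      ∑ i : Fin (q + 1), (-1 : F) ^ (i : ℕ) • Finsupp.single (mergeFun i
        fun x => (singletonsIdx (σ.toEmbedding.trans a) x : ℕ)) (1 : F) =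
      ∑ i : Fin (q + 1), (-1 : F) ^ (i : ℕ) • ∑ σ : Equiv.Perm (Fin (q + 1)),
        ((Equiv.Perm.sign σ : ℤ) : F) • Finsupp.single (mergeFun i
        fun x => (singletonsIdx (σ.toEmbedding.trans a) x : ℕ)) (1 : F) := by
    simp only [Finset.smul_sum]
    rw [Finset.sum_comm]
    exact Finset.sum_congr rfl fun i _ => Finset.sum_congr rfl fun σ _ => smul_comm _ _ _
  rw [hcomm, Fin.sum_univ_succ]
  simp only [Fin.val_succ, hmid, smul_zero, Finset.sum_const_zero, add_zero, Fin.val_zero, pow_zero,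
    one_smul]
  simp only [smul_comm _ ((-1 : F) ^ (q + 1))]
  rw [← Finset.smul_sum, hwrap, smul_smul, ← pow_add, Odd.neg_one_pow ⟨q, by ring⟩, neg_smul,
    one_smul, add_neg_cancel]

theorem singletonsIdx_mem_blocksOn {p : ℕ} (a : Fin p ↪ Fin n) (σ : Equiv.Perm (Fin p)) :
    (fun x => (singletonsIdx (σ.toEmbedding.trans a) x : ℕ)) ∈ blocksOn (univ.map a) p := by
  refine ⟨fun x => Nat.lt_succ_iff.1 (Fin.isLt _), fun i hi hi0 => ?_, fun x => ?_⟩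
  · obtain ⟨j, rfl⟩ := Nat.exists_eq_succ_of_ne_zero hi0
    exact ⟨a (σ ⟨j, hi⟩), congrArg Fin.val (singletonsIdx_apply (σ.toEmbedding.trans a) ⟨j, hi⟩)⟩
  · obtain ⟨j, hj, h1, -⟩ | ⟨hj, h1, -⟩ := singletonsIdx_cases a σ x
    · subst hj
      simp [h1]
    · simp [h1, hj]

theorem antisymmetrization_mem_supported {p : ℕ} (a : Fin p ↪ Fin n) :
    antisymmetrization F a ∈ Finsupp.supported F F (blocksOn (univ.map a) p) :=
  Submodule.sum_mem _ fun σ _ => Submodule.smul_mem _ _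
    (Finsupp.single_mem_supported F _ (singletonsIdx_mem_blocksOn a σ))

/-- Each of the p! summands contributes sgn(σ) times the determinant of the matrix of σ, that is 1.
-/
theorem formCoeff_antisymmetrization_self {p : ℕ} (a : Fin p ↪ Fin n) :
    formCoeff F a (antisymmetrization F a) = (p.factorial : F) := by
  rw [antisymmetrization, map_sum]
  have h : ∀ σ : Equiv.Perm (Fin p), formCoeff F a (((Equiv.Perm.sign σ : ℤ) : F) •
      Finsupp.single (fun x => (singletonsIdx (σ.toEmbedding.trans a) x : ℕ)) 1) = 1 := by
    intro σ
    have hM : (Matrix.of fun i j : Fin p => if (singletonsIdx (σ.toEmbedding.trans a) (a j) : ℕ) =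
        (i : ℕ) + 1 then (1 : F) else 0) = σ.permMatrix F := by
      ext i j
      obtain ⟨l, rfl⟩ := σ.surjective j
      have h1 : singletonsIdx (σ.toEmbedding.trans a) (a (σ l)) = l.succ :=
        singletonsIdx_apply (σ.toEmbedding.trans a) l
      rw [Matrix.of_apply, h1, Equiv.Perm.permMatrix, PEquiv.toMatrix_toPEquiv_apply,
        Pi.single_apply]
      congr 1
      simp [Fin.ext_iff, eq_comm]
    rw [map_smul, formCoeff_single, hM, Matrix.det_permutation, smul_eq_mul, ← Int.cast_mul]
    simp
  rw [Finset.sum_congr rfl fun σ _ => h σ, Finset.sum_const, Finset.card_univ, Fintype.card_perm,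
    Fintype.card_fin, nsmul_one]

theorem formCoeff_antisymmetrization_of_notMem {p : ℕ} (a : Fin p ↪ Fin n) (b : Fin p → Fin n)
    {j : Fin p} (hj : ∀ i, a i ≠ b j) : formCoeff F b (antisymmetrization F a) = 0 := by
  rw [antisymmetrization, map_sum]
  refine Finset.sum_eq_zero fun σ _ => ?_
  rw [map_smul, formCoeff_single, Matrix.det_eq_zero_of_column_eq_zero j, smul_zero]
  intro i
  rw [Matrix.of_apply, singletonsIdx_of_notMem _ _ fun i => hj (σ i)]
  simp

end Representative

/-! ### Filtration by the size of the block of the vertex 0 -/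

section Filtration

/-- The linear projection of a space of finitely supported functions to those supported on `s`. -/
noncomputable def restrictTo (F : Type*) [Field F] {α : Type*} (s : Set α) :
    (α →₀ F) →ₗ[F] (α →₀ F) :=
  open Classical in (Finsupp.supported F F s).subtype ∘ₗ Finsupp.restrictDom F F s

variable {F : Type*} [Field F]

theorem restrictTo_mem {α : Type*} (s : Set α) (z : α →₀ F) :
    restrictTo F s z ∈ Finsupp.supported F F s :=
  Subtype.coe_prop _

theorem restrictTo_of_mem {α : Type*} {s : Set α} {z : α →₀ F}
    (hz : z ∈ Finsupp.supported F F s) : restrictTo F s z = z := by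
  classical
  refine (Finsupp.restrictDom_apply s z).trans (Finsupp.filter_eq_self_iff _ _ |>.2 fun x hx => ?_)
  exact hz (Finsupp.mem_support_iff.2 hx)

theorem restrictTo_eq_zero {α : Type*} {s t : Set α} (hst : Disjoint s t) {z : α →₀ F}
    (hz : z ∈ Finsupp.supported F F t) : restrictTo F s z = 0 := by
  classical
  refine (Finsupp.restrictDom_apply s z).trans (Finsupp.filter_eq_zero_iff _ _ |>.2 fun x hx => ?_)
  exact Finsupp.notMem_support_iff.1 fun h => Set.disjoint_left.1 hst hx (hz h)

theorem innerBoundary_zero {V : Type*} (z : (V → ℕ) →₀ F) : innerBoundary F 0 z = 0 := by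
  simp [innerBoundary, Finsupp.linearCombination_apply]

theorem eq_of_mem_blocksOn {V : Type*} {T T' : Finset V} {p p' : ℕ} {f : V → ℕ}
    (h : f ∈ blocksOn T p) (h' : f ∈ blocksOn T' p') : T = T' := by
  ext x
  exact not_iff_not.1 ((h.2.2 x).symm.trans (h'.2.2 x))

variable {n : ℕ} [NeZero n] {p m : ℕ}

theorem card_zeros_of_mem_blocksOn {n p : ℕ} {T : Finset (Fin n)} {f : Fin n → ℕ}
    (hf : f ∈ blocksOn T p) : (univ.filter fun x => f x = 0).card + T.card = n := by
  have h : (univ.filter fun x => f x = 0) = Tᶜ := by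
    ext x
    simp [hf.2.2 x]
  rw [h, Finset.card_compl_add_card, Fintype.card_fin]

theorem mem_normalizedFaces_of_mem_blocksOn {T : Finset (Fin n)} (h0 : 0 ∉ T)
    (hT : T.card + m ≤ n) {f : Fin n → ℕ} (hf : f ∈ blocksOn T p) :
    f ∈ normalizedFaces n p m := by
  have h := card_zeros_of_mem_blocksOn hf
  have hf0 := (hf.2.2 0).2 h0
  refine ⟨hf0, hf.1, fun i hi => ?_, by lia⟩
  by_cases hi0 : i = 0
  · exact ⟨0, by rw [hf0, hi0]⟩
  · exact hf.2.1 i hi hi0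

theorem exists_mem_blocksOn {f : Fin n → ℕ} (hf : f ∈ normalizedFaces n p m) :
    ∃ T : Finset (Fin n), 0 ∉ T ∧ f ∈ blocksOn T p ∧ T.card + m ≤ n := by
  obtain ⟨h0, h1, h2, h3⟩ := hf
  have h : f ∈ blocksOn (univ.filter fun x => f x ≠ 0) p :=
    ⟨h1, fun i hi _ => h2 i hi, fun x => by simp⟩
  have := card_zeros_of_mem_blocksOn h
  exact ⟨_, by simpa using h0, h, by lia⟩

theorem le_card_of_mem_blocksOn {V : Type*} {T : Finset V} {f : V → ℕ}
    (hf : f ∈ blocksOn T p) : p ≤ T.card := by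
  classical
  have h : Icc 1 p ⊆ T.image f := by
    intro i hi
    rw [Finset.mem_Icc] at hi
    obtain ⟨x, hx⟩ := hf.2.1 i hi.2 (by lia)
    refine Finset.mem_image.2 ⟨x, ?_, hx⟩
    by_contra h
    have := (hf.2.2 x).2 h
    lia
  simpa using (Finset.card_le_card h).trans Finset.card_image_le

theorem add_le_of_mem_normalizedFaces {f : Fin n → ℕ} (hf : f ∈ normalizedFaces n p m) :
    p + m ≤ n := by
  obtain ⟨T, -, h, hT⟩ := exists_mem_blocksOn hf
  have := le_card_of_mem_blocksOn h
  lia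

/-- Common to the two outer terms: the vertex `y` joins the `0`-block, so the filtration level
rises. -/
theorem mem_normalizedFaces_succ {T : Finset (Fin n)} {q r : ℕ} {f g : Fin n → ℕ} (h0 : 0 ∉ T)
    (hf : f ∈ blocksOn T q) (h1 : ∀ x, g x ≤ r) (h2 : ∀ i ≤ r, i ≠ 0 → ∃ x, g x = i)
    (h3 : ∀ x, f x = 0 → g x = 0) {y : Fin n} (hfy : f y ≠ 0) (hgy : g y = 0) :
    g ∈ normalizedFaces n r (n - T.card + 1) := by
  have hg0 : g 0 = 0 := h3 0 ((hf.2.2 0).2 h0)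
  refine ⟨hg0, h1, fun i hi => ?_, ?_⟩
  · by_cases hi0 : i = 0
    · exact ⟨0, by rw [hg0, hi0]⟩
    · exact h2 i hi hi0
  · have hc := card_zeros_of_mem_blocksOn hf
    have hlt : (univ.filter fun x => f x = 0).card < (univ.filter fun x => g x = 0).card := by
      refine Finset.card_lt_card (Finset.ssubset_iff_of_subset ?_ |>.2 ⟨y, ?_, ?_⟩)
      · intro x
        simpa using h3 x
      · simpa using hgy
      · simpa using hfy
    lia

/-- The total boundary agrees with the internal one up to terms with a larger block at the vertex
`0`. -/
theorem totalBoundary_sub_innerBoundary_mem {T : Finset (Fin n)} (h0 : 0 ∉ T)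
    {z : (Fin n → ℕ) →₀ F} (hz : z ∈ Finsupp.supported F F (blocksOn T (p + 1))) :
    totalBoundary F p z - innerBoundary F (p + 1) z ∈
      Finsupp.supported F F (normalizedFaces n p (n - T.card + 1)) := by
  refine apply_mem_of_supported (totalBoundary F p - innerBoundary F (p + 1)) _ (fun f hf => ?_) hz
  have hf' := hf
  obtain ⟨h1, h2, h3⟩ := hf'
  rw [LinearMap.sub_apply, totalBoundary_single, innerBoundary_single,
    Fin.sum_univ_eq_sum_range
      (fun i => (-1 : F) ^ i • Finsupp.single (mergeFun i f) (1 : F)) (p + 1),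
    Finset.range_eq_Ico, Finset.sum_eq_sum_Ico_succ_bot (Nat.succ_pos p), pow_zero, one_smul,
    add_sub_right_comm, zero_add, add_sub_cancel_right]
  refine Submodule.add_mem _ (Finsupp.single_mem_supported F _ ?_)
    (Submodule.smul_mem _ _ (Finsupp.single_mem_supported F _ ?_))
  · obtain ⟨y, hy⟩ := h2 1 (by lia) one_ne_zero
    refine mem_normalizedFaces_succ h0 hf (fun x => ?_) (fun i hi hi0 => ?_) (fun x hx => ?_)
      (y := y) (by lia) ?_
    · have := h1 x
      unfold mergeFun
      grind
    · obtain ⟨x, hx⟩ := h2 (i + 1) (by lia) (by lia)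
      exact ⟨x, by simp [mergeFun, hx]⟩
    · simp [mergeFun, hx]
    · simp [mergeFun, hy]
  · obtain ⟨y, hy⟩ := h2 (p + 1) le_rfl (by lia)
    refine mem_normalizedFaces_succ h0 hf (fun x => ?_) (fun i hi hi0 => ?_) (fun x hx => ?_)
      (y := y) (by lia) ?_
    · unfold wrapFun
      grind
    · obtain ⟨x, hx⟩ := h2 i (by lia) hi0
      exact ⟨x, by unfold wrapFun; grind⟩
    · simp [wrapFun, hx]
    · simp [wrapFun, hy]

theorem disjoint_blocksOn_normalizedFaces {T : Finset (Fin n)} {q : ℕ} (h : n < T.card + m) :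
    Disjoint (blocksOn T q) (normalizedFaces n p m) := by
  refine Set.disjoint_left.2 fun f hf hf' => ?_
  have := card_zeros_of_mem_blocksOn hf
  have := hf'.2.2.2
  lia

/-- At the lowest level the `0`-block complementary to T has the least allowed size m, so no term
that enlarges a `0`-block can land on T. -/
theorem restrictTo_totalBoundary {T : Finset (Fin n)} (h0 : 0 ∉ T) (hT : T.card + m = n)
    {z : (Fin n → ℕ) →₀ F} (hz : z ∈ Finsupp.supported F F (normalizedFaces n (p + 1) m)) :
    restrictTo F (blocksOn T p) (totalBoundary F p z) =
      innerBoundary F (p + 1) (restrictTo F (blocksOn T (p + 1)) z) := by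
  rw [← sub_eq_zero]
  refine (Submodule.mem_bot F).1 (apply_mem_of_supported
    (restrictTo F (blocksOn T p) ∘ₗ totalBoundary F p -
      innerBoundary F (p + 1) ∘ₗ restrictTo F (blocksOn T (p + 1))) _ (fun f hf => ?_) hz)
  obtain ⟨T', h0', hf', hT'⟩ := exists_mem_blocksOn hf
  have hs := Finsupp.single_mem_supported F (1 : F) hf'
  have hsub := restrictTo_eq_zero
    (disjoint_blocksOn_normalizedFaces (T := T) (q := p) (p := p) (m := n - T'.card + 1) (by lia))
    (totalBoundary_sub_innerBoundary_mem h0' hs)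
  rw [map_sub, sub_eq_zero] at hsub
  rw [Submodule.mem_bot, LinearMap.sub_apply, LinearMap.comp_apply, LinearMap.comp_apply, hsub,
    sub_eq_zero]
  have hi := innerBoundary_mem_supported hs
  by_cases hTT : T' = T
  · subst hTT
    rw [restrictTo_of_mem hs]
    exact restrictTo_of_mem hi
  · have hd : ∀ q r, Disjoint (blocksOn T q) (blocksOn T' r) := fun q r =>
      Set.disjoint_left.2 fun f h h' => hTT (eq_of_mem_blocksOn h' h)
    rw [restrictTo_eq_zero (hd _ _) hs, map_zero]
    exact restrictTo_eq_zero (hd _ _) hi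

/-- Quantifying over `q` with `p = q + 1` covers degree `p = 0`, where every chain is a cycle. -/
theorem innerBoundary_restrictTo {T : Finset (Fin n)} (h0 : 0 ∉ T) (hT : T.card + m = n)
    {z : (Fin n → ℕ) →₀ F} (hz : z ∈ Finsupp.supported F F (normalizedFaces n p m))
    (hdz : ∀ q, p = q + 1 → totalBoundary F q z = 0) :
    innerBoundary F p (restrictTo F (blocksOn T p) z) = 0 := by
  rcases p with _ | q
  · exact innerBoundary_zero _
  · rw [← restrictTo_totalBoundary h0 hT hz, hdz q rfl, map_zero]

theorem Index.map_enum {q : ℕ} (A : Index n q) : univ.map A.enum = (insert 0 A.1)ᶜ := by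
  ext x
  rw [← Finset.mem_coe, Finset.coe_map, Finset.coe_univ, Set.image_univ]
  exact iff_of_eq (congrArg (x ∈ ·)
    (Finset.range_orderEmbOfFin ((insert 0 A.1)ᶜ : Finset (Fin n)) A.card_compl))

theorem Index.zero_notMem_map_enum {q : ℕ} (A : Index n q) : 0 ∉ univ.map A.enum := by
  rw [A.map_enum]; simp

theorem Index.map_enum_injective {q : ℕ} {A B : Index n q}
    (h : univ.map A.enum = univ.map B.enum) : A = B := by
  rw [A.map_enum, B.map_enum, compl_inj_iff] at h
  apply Subtype.ext
  rw [← Finset.erase_insert A.2.1, h, Finset.erase_insert B.2.1]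

theorem Index.exists_map_enum_eq {T : Finset (Fin n)} (h0 : 0 ∉ T) {q : ℕ} (hT : T.card = q) :
    ∃ A : Index n q, univ.map A.enum = T := by
  have h1 : (insert 0 T)ᶜ.card + (insert 0 T).card = n := by
    rw [Finset.card_compl_add_card, Fintype.card_fin]
  rw [Finset.card_insert_of_notMem h0, hT] at h1
  refine ⟨⟨(insert 0 T)ᶜ, by simp, h1⟩, ?_⟩
  rw [Index.map_enum, Finset.compl_insert, compl_compl, Finset.erase_insert h0]

theorem sub_sum_restrictTo_mem {q : ℕ} (hq : q + m = n) {z : (Fin n → ℕ) →₀ F}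
    (hz : z ∈ Finsupp.supported F F (normalizedFaces n p m)) :
    z - ∑ A : Index n q, restrictTo F (blocksOn (univ.map A.enum) p) z ∈
      Finsupp.supported F F (normalizedFaces n p (m + 1)) := by
  have key := apply_mem_of_supported (LinearMap.id -
    ∑ A : Index n q, restrictTo F (blocksOn (univ.map A.enum) p))
    (Finsupp.supported F F (normalizedFaces n p (m + 1))) (fun f hf => ?_) hz
  · simpa using key
  obtain ⟨T, h0, hfT, hT⟩ := exists_mem_blocksOn hf
  have hs := Finsupp.single_mem_supported F (1 : F) hfT
  have hd : ∀ A : Index n q, univ.map A.enum ≠ T →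
      restrictTo F (blocksOn (univ.map A.enum) p) (Finsupp.single f 1) = 0 := fun A hA =>
    restrictTo_eq_zero (Set.disjoint_left.2 fun f h h' => hA (eq_of_mem_blocksOn h h')) hs
  rw [LinearMap.sub_apply, LinearMap.sum_apply, LinearMap.id_apply]
  by_cases hTq : T.card = q
  · obtain ⟨A, rfl⟩ := Index.exists_map_enum_eq h0 hTq
    rw [Finset.sum_eq_single A (fun B _ hBA => hd B fun h => hBA (Index.map_enum_injective h))
      (fun h => absurd (Finset.mem_univ A) h), restrictTo_of_mem hs, sub_self]
    exact Submodule.zero_mem _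
  · rw [Finset.sum_eq_zero fun A _ => hd A fun h => hTq (by rw [← h]; simp), sub_zero]
    exact Finsupp.single_mem_supported F _ (mem_normalizedFaces_of_mem_blocksOn h0 (by lia) hfT)

theorem eq_zero_of_mem_supported_of_lt {z : (Fin n → ℕ) →₀ F} (h : n < p + m)
    (hz : z ∈ Finsupp.supported F F (normalizedFaces n p m)) : z = 0 := by
  rw [← Finsupp.support_eq_empty, Finset.eq_empty_iff_forall_notMem]
  intro f hf
  have := add_le_of_mem_normalizedFaces (hz hf)
  lia

/-- In the top degree there are no boundaries, so a cycle is determined by its coefficient at one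
partition `g`. The antisymmetrization is a cycle and is nonzero since its form coefficient is p!;
hence its coefficient at `g` is nonzero. -/
theorem exists_eq_smul_antisymmetrization [CharZero F] (a : Fin p ↪ Fin n) (ha : 0 ∉ univ.map a)
    {z : (Fin n → ℕ) →₀ F} (hz : z ∈ Finsupp.supported F F (blocksOn (univ.map a) p))
    (hdz : innerBoundary F p z = 0) : ∃ c : F, z = c • antisymmetrization F a := by
  obtain ⟨g, -, hg⟩ := exists_innerBoundary_eq (F := F) (univ.map a)
  have hcard : (univ.map a).card = p := by simp
  have hcard' := Finset.card_compl_add_card (univ.map a)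
  rw [Fintype.card_fin, hcard] at hcard'
  have hpm : (univ.map a).card + (univ.map a)ᶜ.card = n := by rw [hcard]; lia
  have hzero : ∀ z ∈ Finsupp.supported F F (blocksOn (univ.map a) p), innerBoundary F p z = 0 →
      z g = 0 → z = 0 := by
    intro z hz hdz hzg
    obtain ⟨w, hw, rfl⟩ := hg p z hz hdz hzg
    have : w = 0 := by
      refine eq_zero_of_mem_supported_of_lt (p := p + 1) (m := (univ.map a)ᶜ.card) (by lia)
        (Finsupp.supported_mono (fun f hf => ?_) hw)
      exact mem_normalizedFaces_of_mem_blocksOn ha hpm.le hf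
    rw [this, map_zero]
  have hρ := antisymmetrization_mem_supported (F := F) a
  have hdρ : innerBoundary F p (antisymmetrization F a) = 0 := by
    have := innerBoundary_restrictTo ha hpm (Finsupp.supported_mono
      (fun f hf => mem_normalizedFaces_of_mem_blocksOn ha hpm.le hf) hρ) (fun q hq => by
        subst hq
        exact totalBoundary_antisymmetrization a)
    rwa [restrictTo_of_mem hρ] at this
  have hρg : antisymmetrization F a g ≠ 0 := by
    intro h
    have h1 := formCoeff_antisymmetrization_self (F := F) a
    rw [hzero _ hρ hdρ h, map_zero] at h1
    exact Nat.cast_ne_zero.2 (Nat.factorial_ne_zero p) h1.symm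
  refine ⟨z g / antisymmetrization F a g, sub_eq_zero.1 (hzero _
    (Submodule.sub_mem _ hz (Submodule.smul_mem _ _ hρ)) ?_ ?_)⟩
  · rw [map_sub, map_smul, hdz, hdρ, smul_zero, sub_zero]
  · rw [Finsupp.sub_apply, Finsupp.smul_apply, smul_eq_mul, div_mul_cancel₀ _ hρg, sub_self]

/-- Every cycle is homologous to a combination of antisymmetrizations. -/
theorem exists_sub_totalBoundary_mem_span [CharZero F] (hm : 1 ≤ m) {z : (Fin n → ℕ) →₀ F}
    (hz : z ∈ Finsupp.supported F F (normalizedFaces n p m))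
    (hdz : ∀ q, p = q + 1 → totalBoundary F q z = 0) :
    ∃ w ∈ Finsupp.supported F F (normalizedFaces n (p + 1) m), z - totalBoundary F p w ∈
      Submodule.span F (Set.range fun A : Index n p => antisymmetrization F A.enum) := by
  induction hd : n + 1 - m generalizing m z with
  | zero =>
    refine ⟨0, Submodule.zero_mem _, ?_⟩
    rw [eq_zero_of_mem_supported_of_lt (by lia) hz, map_zero, sub_zero]
    exact Submodule.zero_mem _
  | succ d ih =>
    obtain ⟨q, hq⟩ : ∃ q, q + m = n := ⟨n - m, by lia⟩
    have hsum := sub_sum_restrictTo_mem hq hz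
    have hcard : ∀ A : Index n q, (univ.map A.enum).card = q := fun A => by simp
    have hT : ∀ A : Index n q, (univ.map A.enum).card + m = n := fun A => by rw [hcard, hq]
    have hcyc : ∀ A : Index n q,
        innerBoundary F p (restrictTo F (blocksOn (univ.map A.enum) p) z) = 0 := fun A =>
      innerBoundary_restrictTo A.zero_notMem_map_enum (hT A) hz hdz
    by_cases hpq : p = q
    · subst hpq
      refine ⟨0, Submodule.zero_mem _, ?_⟩
      -- The remainder would need a `0`-block of size m + 1 and p further blocks, more than n
      -- vertices.
      rw [map_zero, sub_zero, sub_eq_zero.1 (eq_zero_of_mem_supported_of_lt (by lia) hsum)]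
      refine Submodule.sum_mem _ fun A _ => ?_
      obtain ⟨c, hc⟩ := exists_eq_smul_antisymmetrization A.enum A.zero_notMem_map_enum
        (restrictTo_mem _ z) (hcyc A)
      rw [hc]
      exact Submodule.smul_mem _ _ (Submodule.subset_span ⟨A, rfl⟩)
    · have hex : ∀ A : Index n q, ∃ w ∈ Finsupp.supported F F (blocksOn (univ.map A.enum) (p + 1)),
          innerBoundary F (p + 1) w = restrictTo F (blocksOn (univ.map A.enum) p) z := by
        intro A
        obtain ⟨g, hg, h⟩ := exists_innerBoundary_eq (F := F) (univ.map A.enum)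
        -- For p ≠ #T the coefficient at `g` vanishes automatically, as `g` has #T nonzero
        -- positions.
        refine h p _ (restrictTo_mem _ z) (hcyc A) (Finsupp.notMem_support_iff.1 fun hgs => hpq ?_)
        rw [hcard] at hg
        exact blocksOn_disjoint (restrictTo_mem _ z hgs) hg
      choose w hw hwz using hex
      have hwm : ∑ A, w A ∈ Finsupp.supported F F (normalizedFaces n (p + 1) m) :=
        Submodule.sum_mem _ fun A _ => Finsupp.supported_mono (fun f hf =>
          mem_normalizedFaces_of_mem_blocksOn A.zero_notMem_map_enum (hT A).le hf) (hw A)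
      -- The inner boundaries of the `w A` cancel the leading part of `z`; their outer terms lie one
      -- level deeper.
      have hz' : z - totalBoundary F p (∑ A, w A) ∈
          Finsupp.supported F F (normalizedFaces n p (m + 1)) := by
        have h : z - totalBoundary F p (∑ A, w A) =
            (z - ∑ A : Index n q, restrictTo F (blocksOn (univ.map A.enum) p) z) -
              ∑ A, (totalBoundary F p (w A) - innerBoundary F (p + 1) (w A)) := by
          rw [map_sum, Finset.sum_sub_distrib]
          simp only [hwz]
          abel
        rw [h]
        refine Submodule.sub_mem _ hsum (Submodule.sum_mem _ fun A _ => ?_)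
        have := totalBoundary_sub_innerBoundary_mem A.zero_notMem_map_enum (hw A)
        rwa [hcard, show n - q + 1 = m + 1 by lia] at this
      obtain ⟨w', hw', h⟩ := ih (by lia) hz' (fun r hr => by
        subst hr
        rw [map_sub, hdz r rfl, totalBoundary_totalBoundary hm hwm, sub_zero]) (by lia)
      refine ⟨∑ A, w A + w', Submodule.add_mem _ hwm (Finsupp.supported_mono ?_ hw'), ?_⟩
      · exact fun f hf => ⟨hf.1, hf.2.1, hf.2.2.1, by have := hf.2.2.2; lia⟩
      · rwa [map_add, ← sub_sub]

end Filtration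

/-! ### Basis and dimension of the homology -/

section Homology

variable {F : Type*} [Field F] {n k p : ℕ} [NeZero n]

theorem normalForm_representative (hp : p + k ≤ n) (hk : 1 ≤ k) (A : Index n p) :
    normalForm F (vertexOne n k) p (representative F hp hk A) = antisymmetrization F A.enum := by
  rw [representative, map_sum, antisymmetrization]
  refine Finset.sum_congr rfl fun σ _ => ?_
  rw [map_smul, normalForm_bracket]
  · rfl
  · exact singletonsIdx_of_notMem _ _ fun i => A.enum_ne_zero (σ i)

theorem mem_cycles_succ_iff {c : Chain F (vertexOne n k) (p + 1)} :
    c ∈ cycles F (vertexOne n k) (p + 1) ↔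
      totalBoundary F p (normalForm F (vertexOne n k) (p + 1) c) = 0 := by
  rw [← normalForm_boundary]
  exact ⟨fun h => by rw [show boundary F (vertexOne n k) p c = 0 from h, map_zero],
    fun h => normalForm_injective (h.trans (map_zero _).symm)⟩

theorem representative_mem_cycles (hp : p + k ≤ n) (hk : 1 ≤ k) (A : Index n p) :
    representative F hp hk A ∈ cycles F (vertexOne n k) p := by
  rcases p with _ | q
  · trivial
  · rw [mem_cycles_succ_iff, normalForm_representative, totalBoundary_antisymmetrization]

theorem formCoeff_antisymmetrization_enum (A B : Index n p) :
    formCoeff F B.enum (antisymmetrization F A.enum) = if A = B then (p.factorial : F) else 0 := by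
  split_ifs with h
  · rw [h, formCoeff_antisymmetrization_self]
  · by_contra hne
    refine h (Index.map_enum_injective (Eq.symm (Finset.eq_of_subset_of_card_le ?_ (by simp))))
    intro x hx
    by_contra hxA
    obtain ⟨j, -, rfl⟩ := Finset.mem_map.1 hx
    exact hne (formCoeff_antisymmetrization_of_notMem A.enum B.enum (j := j)
      fun i hi => hxA (Finset.mem_map.2 ⟨i, Finset.mem_univ i, hi⟩))

/-- There are already no chains: the `0`-block needs k vertices and the p other blocks at least one
each. -/
theorem subsingleton_HC_of_lt (h : n < p + k) : Subsingleton (HC F (vertexOne n k) p) := by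
  have : Subsingleton (Chain F (vertexOne n k) p) := by
    refine ⟨fun c d => normalForm_injective ?_⟩
    rw [eq_zero_of_mem_supported_of_lt h (normalForm_mem_supported c),
      eq_zero_of_mem_supported_of_lt h (normalForm_mem_supported d)]
  exact (Submodule.Quotient.mk_surjective _).subsingleton

/-- Applying the form coefficient of B to a relation kills the boundary and leaves p! times the
coefficient of B. -/
theorem linearIndependent_homologyClass [CharZero F] (hp : p + k ≤ n) (hk : 1 ≤ k) :
    LinearIndependent F fun A : Index n p =>
      homologyClass ⟨representative F hp hk A, representative_mem_cycles hp hk A⟩ := by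
  rw [Fintype.linearIndependent_iff]
  intro c hc B
  have hmem : (Submodule.Quotient.mk (∑ A : Index n p, c A •
      (⟨representative F hp hk A, representative_mem_cycles hp hk A⟩ :
        cycles F (vertexOne n k) p)) : HC F (vertexOne n k) p) = 0 := by
    rw [← Submodule.mkQ_apply, map_sum]
    simp only [map_smul]
    exact hc
  rw [Submodule.Quotient.mk_eq_zero, Submodule.submoduleOf, Submodule.mem_comap,
    Submodule.subtype_apply] at hmem
  obtain ⟨w, hw⟩ := hmem
  have h1 := congrArg (fun c => formCoeff F B.enum (normalForm F (vertexOne n k) p c)) hw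
  simp only [normalForm_boundary, formCoeff_totalBoundary, Submodule.coe_sum, Submodule.coe_smul,
    map_sum, map_smul, normalForm_representative, formCoeff_antisymmetrization_enum, smul_eq_mul,
    mul_ite, mul_zero, Finset.sum_ite_eq', Finset.mem_univ, if_true] at h1
  exact (mul_eq_zero.1 h1.symm).resolve_right (Nat.cast_ne_zero.2 (Nat.factorial_ne_zero p))

theorem span_homologyClass_eq_top [CharZero F] (hp : p + k ≤ n) (hk : 1 ≤ k) :
    Submodule.span F (Set.range fun A : Index n p =>
      homologyClass ⟨representative F hp hk A, representative_mem_cycles (F := F) hp hk A⟩) = ⊤ := by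
  rw [eq_top_iff]
  rintro x -
  obtain ⟨z, rfl⟩ := Submodule.Quotient.mk_surjective _ x
  obtain ⟨w, hw, hzw⟩ := exists_sub_totalBoundary_mem_span hk (normalForm_mem_supported z.1)
    (fun q hq => by
      subst hq
      exact mem_cycles_succ_iff.1 z.2)
  obtain ⟨w, rfl⟩ := exists_normalForm_eq hk hw
  obtain ⟨c, hc⟩ := (Submodule.mem_span_range_iff_exists_fun F).1 hzw
  have hz : z.1 - ∑ A : Index n p, c A • representative F hp hk A =
      boundary F (vertexOne n k) p w := by
    refine normalForm_injective ?_
    rw [map_sub, map_sum, normalForm_boundary, sub_eq_iff_eq_add, ← sub_eq_iff_eq_add', ← hc]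
    simp only [map_smul, normalForm_representative]
  have hx : (Submodule.Quotient.mk z : HC F (vertexOne n k) p) = ∑ A : Index n p, c A •
      homologyClass ⟨representative F hp hk A, representative_mem_cycles hp hk A⟩ := by
    have : ∑ A : Index n p, c A • homologyClass
        ⟨representative F hp hk A, representative_mem_cycles hp hk A⟩ =
        (Submodule.Quotient.mk (∑ A : Index n p, c A •
          (⟨representative F hp hk A, representative_mem_cycles hp hk A⟩ :
            cycles F (vertexOne n k) p)) : HC F (vertexOne n k) p) := by
      rw [← Submodule.mkQ_apply, map_sum]
      simp only [map_smul]
      rfl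
    rw [this, Submodule.Quotient.eq, Submodule.submoduleOf, Submodule.mem_comap,
    Submodule.subtype_apply]
    refine ⟨w, ?_⟩
    rw [← hz]
    simp
  rw [hx]
  exact Submodule.sum_mem _ fun A _ => Submodule.smul_mem _ _ (Submodule.subset_span ⟨A, rfl⟩)

/-- The basis of the homology given by the classes of the representatives. -/
noncomputable def homologyBasis (F : Type*) [Field F] [CharZero F] (hp : p + k ≤ n) (hk : 1 ≤ k) :
    Module.Basis (Index n p) F (HC F (vertexOne n k) p) :=
  Module.Basis.mk (linearIndependent_homologyClass hp hk) (span_homologyClass_eq_top hp hk).ge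

theorem card_Index (hp : p + 1 ≤ n) : Fintype.card (Index n p) = (n - 1).choose p := by
  rw [Fintype.card_subtype, ← Nat.choose_symm (by lia)]
  have h : (univ.filter fun A : Finset (Fin n) => 0 ∉ A ∧ A.card + (p + 1) = n) =
      powersetCard (n - 1 - p) (univ.erase 0) := by
    ext A
    rw [Finset.mem_filter, Finset.mem_powersetCard, Finset.subset_erase]
    have : A.card + (p + 1) = n ↔ A.card = n - 1 - p := by lia
    simp [this]
  rw [h, Finset.card_powersetCard, Finset.card_erase_of_mem (Finset.mem_univ _), Finset.card_univ,
    Fintype.card_fin]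

end Homology

end CyclicColoring

theorem theorem3p1 (F : Type*) [Field F] [CharZero F] (n k : ℕ) [NeZero n] (hk : 1 ≤ k) :
    (∀ p : ℕ, p + k ≤ n →
      Module.finrank F (CyclicColoring.HC F (CyclicColoring.vertexOne n k) p)
          = (n - 1).choose p ∧
      Module.finrank F (CyclicColoring.HC F (CyclicColoring.vertexOne n k) p) ≠ 0) ∧
    (∀ p : ℕ, n < p + k →
      Subsingleton (CyclicColoring.HC F (CyclicColoring.vertexOne n k) p)) ∧
    (∀ (p : ℕ) (hp : p + k ≤ n),
      ∃ (hz : ∀ A : CyclicColoring.Index n p,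
          CyclicColoring.representative F hp hk A ∈
            CyclicColoring.cycles F (CyclicColoring.vertexOne n k) p)
        (b : Module.Basis (CyclicColoring.Index n p) F
          (CyclicColoring.HC F (CyclicColoring.vertexOne n k) p)),
        ∀ A, b A = CyclicColoring.homologyClass
          ⟨CyclicColoring.representative F hp hk A, hz A⟩) := by
  refine ⟨fun p hp => ?_, fun p hp => CyclicColoring.subsingleton_HC_of_lt hp, fun p hp =>
    ⟨CyclicColoring.representative_mem_cycles hp hk, CyclicColoring.homologyBasis F hp hk,
      fun A => Module.Basis.mk_apply _ _ A⟩⟩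
  rw [Module.finrank_eq_card_basis (CyclicColoring.homologyBasis F hp hk),
    CyclicColoring.card_Index (by lia)]
  exact ⟨rfl, (Nat.choose_pos (by lia)).ne'⟩
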